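/- \textbf{Conventions.} $\hat f(\omega)=\int_{\mathbb R}f(x)e^{-j\omega x}\,dx$ denotes the Fourier transform on $L^2(\mathbb R)$ (complex-valued functions), fractional powers are taken on the principal branch, and functions of $\omega$ are understood almost everywhere. The Hilbert transform $\mathscr H$ on $L^2(\mathbb R)$ is defined by $\widehat{\mathscr Hf}(\omega)=-j\,\mathrm{sign}(\omega)\hat f(\omega)$, and the fractional Hilbert transform (fHT) with shift $\bar\tau\in\mathbb R$ by $\mathcal H_{\bar\tau}=\cos(\pi\bar\tau)\,I-\sin(\pi\bar\tau)\,\mathscr H$. For $\alpha\ge 0$ and $\tau\in\mathbb R$, the fractional B-spline $\beta^\alpha_\tau$ of degree $\alpha$ and shift $\tau$ is the function with $$\hat\beta^\alpha_\tau(\omega)=\Big(\frac{1-e^{-j\omega}}{j\omega}\Big)^{\frac{\alpha+1}2+\tau}\Big(\frac{1-e^{j\omega}}{-j\omega}\Big)^{\frac{\alpha+1}2-\tau},$$ and the dual spline $\mathring\beta^\alpha_\tau$ is the function with Fourier transform $\hat\beta^\alpha_\tau(\omega)\big/\sum_{k\in\mathbb Z}|\hat\beta^\alpha_\tau(\omega+2\pi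 k)|^2$. The refinement filter is $$H^\alpha_\tau(e^{j\omega})=2^{-(\alpha+1)}(1+e^{-j\omega})^{\frac{\alpha+1}2+\tau}(1+e^{j\omega})^{\frac{\alpha+1}2-\tau}.$$ For a square-integrable function $Q$ on the unit circle put $G^{\alpha}_{\tau}(e^{j\omega})=e^{j\omega}\,Q(-e^{-j\omega})\,H^\alpha_\tau(-e^{-j\omega})=\sum_{k}g^\alpha_\tau[k]e^{-jk\omega}$. The spline wavelet $\psi^\alpha_\tau$ of genus $Q$ is given by $\psi^\alpha_\tau(x/2)=\sum_{k\in\mathbb Z}g^\alpha_\tau[k]\,\beta^\alpha_\tau(x-k)$. The dual spline wavelet $\tilde\psi^\alpha_\tau$ of genus $\tilde Q$ is given in the same way, with $\tilde Q$ in place of $Q$ and $\mathring\beta^\alpha_\tau$ in place of $\beta^\alpha_\tau$. The genus (orthonormal, B-spline, dual, etc.) is encoded in the filters $Q,\tilde Q$, which do not depend on $\tau$. For $\psi\in L^2(\mathbb R)$ let $\psi_{i,k}(x)=2^{i/2}\psi(2^ix-k)$, $(i,k)\in\mathbb Z^2$. \textbf{Proposition.} Let $\alpha\ge0$, and let $Q,\tilde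 Q$ be square-integrable functions on the unit circle. For every $\tau\in\mathbb R$ the functions $\beta^\alpha_\tau$, $\mathring\beta^\alpha_\tau$ are well defined in $L^2(\mathbb R)$ and satisfy $\langle\beta^\alpha_\tau(\cdot-m),\mathring\beta^\alpha_\tau(\cdot-n)\rangle=\delta[m-n]$ for all $m,n\in\mathbb Z$; the series defining $\psi^\alpha_\tau$ and $\tilde\psi^\alpha_\tau$ converge unconditionally in $L^2(\mathbb R)$. The fHT of a spline wavelet is a spline wavelet of the same genus and degree, but with a different shift: for all $\tau,\bar\tau\in\mathbb R$, $$\mathcal H_{\bar\tau}\psi^\alpha_\tau=\psi^\alpha_{\tau-\bar\tau},\qquad \mathcal H_{\bar\tau}\tilde\psi^\alpha_\tau=\tilde\psi^\alpha_{\tau-\bar\tau}.$$ Moreover, if the family $\{(\psi^\alpha_\tau)_{i,k}\}$ is orthonormal, or orthogonal across different scales $i$, or biorthogonal to $\{(\tilde\psi^\alpha_\tau)_{i,k}\}$, then the same holds with $\tau$ replaced by $\tau-\bar\tau$. -/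

import Mathlib

open MeasureTheory
open scoped FourierTransform

noncomputable section

/-- `L²(ℝ)`, the space of (complex) finite-energy signals. -/
abbrev L2R : Type := Lp ℂ 2 (volume : Measure ℝ)

/-! ### Affine changes of variable on `L²(ℝ)` -/

theorem memLp_comp_affine (c d : ℝ) (hc : c ≠ 0) (f : L2R) :
    MemLp (fun x : ℝ => f (c * x - d)) 2 (volume : Measure ℝ) := by
  have h1 : MemLp (fun x : ℝ => f (x - d)) 2 (volume : Measure ℝ) :=
    (Lp.memLp f).comp_measurePreserving (measurePreserving_sub_right volume d)
  have hmap := Real.map_volume_mul_left hc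
  have h2 : MemLp (fun x : ℝ => f (x - d)) 2 (Measure.map (fun x : ℝ => c * x) volume) := by
    rw [hmap]
    exact h1.smul_measure ENNReal.ofReal_ne_top
  exact h2.comp_of_map (by fun_prop)

/-- `x ↦ f (c x - d)` as an element of `L²(ℝ)`, for `c ≠ 0`. -/
def affineComp (c d : ℝ) (hc : c ≠ 0) (f : L2R) : L2R :=
  (memLp_comp_affine c d hc f).toLp

/-- The integer translate `x ↦ f (x - k)`. -/
def intTranslate (k : ℤ) (f : L2R) : L2R := affineComp 1 k one_ne_zero f

/-- The dyadic dilate-translate `Ξ_{i,k} ψ (x) = 2^{i/2} ψ (2^i x - k)`, with `p = (i, k)`. -/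
def dyadic (p : ℤ × ℤ) (ψ : L2R) : L2R :=
  (((2 : ℝ) ^ ((p.1 : ℝ) / 2) : ℝ) : ℂ) •
    affineComp ((2 : ℝ) ^ p.1) (p.2 : ℝ) (zpow_ne_zero _ two_ne_zero) ψ

/-! ### The Hilbert transform and the fractional Hilbert transform -/

theorem memLp_hilbert (f : L2R) :
    MemLp (fun ξ : ℝ => -Complex.I * ((SignType.sign ξ : ℝ) : ℂ) * (𝓕 f : L2R) ξ) 2
      (volume : Measure ℝ) := by
  have hsign : Measurable (fun ξ : ℝ => ((SignType.sign ξ : ℝ))) := by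
    have : (fun ξ : ℝ => ((SignType.sign ξ : ℝ))) = fun ξ : ℝ =>
        if 0 < ξ then (1 : ℝ) else if ξ < 0 then -1 else 0 := by
      funext ξ
      rcases lt_trichotomy ξ 0 with h | h | h
      · simp [h, h.not_gt]
      · simp [h]
      · simp [h]
    rw [this]
    exact Measurable.ite measurableSet_Ioi measurable_const
      (Measurable.ite measurableSet_Iio measurable_const measurable_const)
  refine MemLp.of_le (Lp.memLp (𝓕 f : L2R)) ?_ (Filter.Eventually.of_forall fun ξ => ?_)
  · exact (measurable_const.mul (Complex.measurable_ofReal.comp hsign)).aestronglyMeasurable.mul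
      (Lp.aestronglyMeasurable _)
  · have h1 : ‖-Complex.I * ((SignType.sign ξ : ℝ) : ℂ)‖ ≤ 1 := by
      rcases lt_trichotomy ξ 0 with h | h | h <;> simp [h]
    rw [norm_mul]
    exact mul_le_of_le_one_left (norm_nonneg _) h1

/-- The Hilbert transform on `L²(ℝ)`: the Fourier multiplier `-j sign(ω)`. The sign of a frequency
does not depend on whether it is measured as `ω` or as `ξ = ω / 2π`. -/
def hilbertTransform (f : L2R) : L2R := 𝓕⁻ (memLp_hilbert f).toLp

/-- The fractional Hilbert transform `H_τ = cos(πτ) I - sin(πτ) H`. -/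
def fHT (τ : ℝ) (f : L2R) : L2R :=
  ((Real.cos (Real.pi * τ) : ℝ) : ℂ) • f -
    ((Real.sin (Real.pi * τ) : ℝ) : ℂ) • hilbertTransform f

/-! ### Signals specified by their Fourier transform -/

/-- `f ↔ m`: the Fourier transform `∫ f(x) exp(-jωx) dx` of `f` is `m(ω)` for almost every `ω`.
The transform `𝓕` is normalised as `𝓕 f (ξ) = ∫ f(x) exp(-2πjξx) dx`, so `ω = 2πξ`. -/
def HasAngularFourier (f : L2R) (m : ℝ → ℂ) : Prop :=
  ∀ᵐ ξ : ℝ, (𝓕 f : L2R) ξ = m (2 * Real.pi * ξ)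

open Classical in
/-- The element of `L²(ℝ)` whose Fourier transform is `m(ω)` (zero if `m` is not in `L²`). -/
def ofAngularFourier (m : ℝ → ℂ) : L2R :=
  if h : MemLp (fun ξ : ℝ => m (2 * Real.pi * ξ)) 2 (volume : Measure ℝ) then 𝓕⁻ h.toLp else 0

/-! ### Fractional B-splines and their duals -/

/-- `(1 - exp(-jω)) / (jω)`, with its limit value `1` at `ω = 0`. -/
def bsplineBase (ω : ℝ) : ℂ :=
  if ω = 0 then 1 else (1 - Complex.exp (-(Complex.I * ω))) / (Complex.I * ω)

/-- The Fourier transform of the fractional B-spline of degree `α` and shift `τ`. The second base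
`(1 - exp(jω)) / (-jω)` is the first one at `-ω`. Powers are taken on the principal branch. -/
def bsplineFT (α τ ω : ℝ) : ℂ :=
  bsplineBase ω ^ (((α + 1) / 2 + τ : ℝ) : ℂ) * bsplineBase (-ω) ^ (((α + 1) / 2 - τ : ℝ) : ℂ)

/-- The fractional B-spline of degree `α` and shift `τ`. -/
def bspline (α τ : ℝ) : L2R := ofAngularFourier (bsplineFT α τ)

/-- The transfer function `∑_k |β̂(ω + 2πk)|²` of the autocorrelation filter of the B-spline. -/
def bsplineGram (α τ ω : ℝ) : ℝ := ∑' k : ℤ, ‖bsplineFT α τ (ω + 2 * Real.pi * k)‖ ^ 2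

/-- The Fourier transform of the dual spline function. -/
def dualBsplineFT (α τ ω : ℝ) : ℂ := bsplineFT α τ ω / ((bsplineGram α τ ω : ℝ) : ℂ)

/-- The dual spline function: the function in the span of the integer translates of the B-spline
that is biorthogonal to these translates. -/
def dualBspline (α τ : ℝ) : L2R := ofAngularFourier (dualBsplineFT α τ)

/-! ### Filters and wavelets -/

/-- The spline refinement filter
`H(z) = 2^{-(α+1)} (1 + z⁻¹)^{(α+1)/2+τ} (1 + z)^{(α+1)/2-τ}`, on `|z| = 1`. -/
def refinementFilter (α τ : ℝ) (z : ℂ) : ℂ :=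
  ((((2 : ℝ) ^ (α + 1))⁻¹ : ℝ) : ℂ) *
    ((1 + z⁻¹) ^ (((α + 1) / 2 + τ : ℝ) : ℂ) * (1 + z) ^ (((α + 1) / 2 - τ : ℝ) : ℂ))

/-- The wavelet filter `G(z) = z Q(-z⁻¹) H(-z⁻¹)`, on `|z| = 1`. -/
def waveletFilter (α τ : ℝ) (Q : ℂ → ℂ) (z : ℂ) : ℂ :=
  z * Q (-z⁻¹) * refinementFilter α τ (-z⁻¹)

/-- `Q` is (on the unit circle) the transfer function of a finite-energy discrete filter. -/
def IsFilter (Q : ℂ → ℂ) : Prop :=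
  MemLp (fun ω : ℝ => Q (Complex.exp (Complex.I * ω))) 2
    (volume.restrict (Set.Ioc (-Real.pi) Real.pi))

/-- The impulse response `g[k]` of the filter with transfer function
`G(exp(jω)) = ∑_k g[k] exp(-jkω)`. -/
def impulseResponse (G : ℂ → ℂ) (k : ℤ) : ℂ :=
  ((2 * Real.pi : ℝ) : ℂ)⁻¹ * ∫ ω in (-Real.pi)..Real.pi,
    G (Complex.exp (Complex.I * ω)) * Complex.exp (Complex.I * k * ω)

/-- The function `ψ` generated from `φ` by the filter `G`: `ψ(x/2) = ∑_k g[k] φ(x - k)`. -/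
def generate (G : ℂ → ℂ) (φ : L2R) : L2R :=
  affineComp 2 0 two_ne_zero (∑' k : ℤ, impulseResponse G k • intTranslate k φ)

/-- The series `∑_k g[k] φ(x - k)` converges in `L²(ℝ)` (unconditionally) to `ψ(x/2)`. -/
def IsGenerated (G : ℂ → ℂ) (φ ψ : L2R) : Prop :=
  HasSum (fun k : ℤ => impulseResponse G k • intTranslate k φ)
    (affineComp 2⁻¹ 0 (inv_ne_zero two_ne_zero) ψ)

/-- The spline wavelet of degree `α` and shift `τ`, of the genus given by the filter `Q`. -/
def splineWavelet (α : ℝ) (Q : ℂ → ℂ) (τ : ℝ) : L2R :=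
  generate (waveletFilter α τ Q) (bspline α τ)

/-- The dual spline wavelet of degree `α` and shift `τ`, of the genus given by the filter `Q`:
it is generated by the dual spline function. -/
def dualSplineWavelet (α : ℝ) (Q : ℂ → ℂ) (τ : ℝ) : L2R :=
  generate (waveletFilter α τ Q) (dualBspline α τ)

/-- The dyadic families of `ψ` and `ψ'` are biorthogonal. -/
def IsDualPair (ψ ψ' : L2R) : Prop :=
  ∀ p q : ℤ × ℤ, inner ℂ (dyadic p ψ) (dyadic q ψ') = if p = q then 1 else 0

/-- The dyadic family of `ψ` is orthonormal. -/
def IsOrthonormalWavelet (ψ : L2R) : Prop := Orthonormal ℂ fun p : ℤ × ℤ => dyadic p ψ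

/-- Members of the dyadic family of `ψ` at different scales are orthogonal. -/
def IsSemiorthogonalWavelet (ψ : L2R) : Prop :=
  ∀ p q : ℤ × ℤ, p.1 ≠ q.1 → inner ℂ (dyadic p ψ) (dyadic q ψ) = 0

end

open scoped ENNReal

/-! On the Fourier side `fHT τ'` is multiplication by `exp(jπτ' sign ω)`. This multiplier is
unimodular and invariant under positive dilations, and translations are multipliers too. Hence the
operator preserves inner products and commutes with `dyadic` (`inner_dyadic_fHT`), so every
orthogonality relation passes to the image.

Lowering the shift by `τ'` produces the same multiplier. Put `u = 1 - exp(-jω)`. The spline is built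
from powers of `u / (jω)` and of its conjugate, whose exponents have a fixed sum and difference
`2τ`; so its modulus ignores `τ`, and the new shift contributes `exp(-2jτ' arg(u / (jω)))`. The
wavelet filter contains the same kind of product with `u` and its conjugate exchanged, and
contributes `exp(2jτ' arg u)`. As `arg(u / (jω)) = arg u - (π/2) sign ω` (`arg_bsplineBase`), the
two phases combine to the multiplier (`waveletFilter_mul_bsplineFT_sub`). The Gram function sees
only moduli, so the dual splines acquire the same phase.

The analysis rests on periodisation. If `∑ₖ |m(ξ + k)|²` is bounded, then `p ↦ p m` is bounded from
`L²` of the circle to `L²(ℝ)` (`synthesisCLM`) and carries the Fourier series of a filter to a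
series of translates; this gives both the convergence and the Fourier transform of the sum
(`exists_hasSum_intTranslate`). The upper bound on `bsplineGram` supplies the hypothesis for the
splines, the lower bound for the duals. -/

/-! ### Affine changes of variable and phase multiplication as operators on `L²(ℝ)`. -/

theorem map_affine_volume (c d : ℝ) (hc : c ≠ 0) :
    Measure.map (fun x : ℝ => c * x - d) volume = ENNReal.ofReal |c⁻¹| • (volume : Measure ℝ) := by
  have h : (fun x : ℝ => c * x - d) = (fun x => x - d) ∘ fun x => c * x := rfl
  rw [h, ← Measure.map_map (by fun_prop) (by fun_prop), Real.map_volume_mul_left hc,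
    Measure.map_smul, (measurePreserving_sub_right volume d).map_eq]

theorem quasiMeasurePreserving_affine (c d : ℝ) (hc : c ≠ 0) :
    Measure.QuasiMeasurePreserving (fun x : ℝ => c * x - d) volume volume := by
  refine ⟨by fun_prop, ?_⟩
  rw [map_affine_volume c d hc]
  exact Measure.smul_absolutelyContinuous

theorem coeFn_affineComp (c d : ℝ) (hc : c ≠ 0) (f : L2R) :
    affineComp c d hc f =ᵐ[volume] fun x => f (c * x - d) :=
  (memLp_comp_affine c d hc f).coeFn_toLp

theorem affineComp_add (c d : ℝ) (hc : c ≠ 0) (f g : L2R) :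
    affineComp c d hc (f + g) = affineComp c d hc f + affineComp c d hc g := by
  apply Lp.ext
  filter_upwards [coeFn_affineComp c d hc (f + g), coeFn_affineComp c d hc f,
    coeFn_affineComp c d hc g, Lp.coeFn_add (affineComp c d hc f) (affineComp c d hc g),
    (quasiMeasurePreserving_affine c d hc).ae (Lp.coeFn_add f g)] with x h1 h2 h3 h4 h5
  simp only [h1, h4, Pi.add_apply, h2, h3, h5]

theorem affineComp_smul (c d : ℝ) (hc : c ≠ 0) (a : ℂ) (f : L2R) :
    affineComp c d hc (a • f) = a • affineComp c d hc f := by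
  apply Lp.ext
  filter_upwards [coeFn_affineComp c d hc (a • f), coeFn_affineComp c d hc f,
    Lp.coeFn_smul a (affineComp c d hc f),
    (quasiMeasurePreserving_affine c d hc).ae (Lp.coeFn_smul a f)] with x h1 h2 h3 h4
  simp only [h1, h3, Pi.smul_apply, h2, h4]

theorem norm_affineComp (c d : ℝ) (hc : c ≠ 0) (f : L2R) :
    ‖affineComp c d hc f‖ = |c⁻¹| ^ (1 / 2 : ℝ) * ‖f‖ := by
  have h : eLpNorm (fun x => f (c * x - d)) 2 volume =
      ENNReal.ofReal |c⁻¹| ^ (1 / 2 : ℝ) * eLpNorm f 2 volume := by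
    have hm : AEStronglyMeasurable f (Measure.map (fun x : ℝ => c * x - d) volume) := by
      rw [map_affine_volume c d hc]
      exact (Lp.aestronglyMeasurable f).smul_measure _
    have := eLpNorm_map_measure (p := 2) hm (by fun_prop : AEMeasurable (fun x : ℝ => c * x - d))
    rw [Function.comp_def] at this
    rw [← this, map_affine_volume c d hc, eLpNorm_smul_measure_of_ne_top (by simp)]
    simp
  rw [affineComp, Lp.norm_toLp, h, ENNReal.toReal_mul, ← ENNReal.toReal_rpow,
    ENNReal.toReal_ofReal (abs_nonneg _), Lp.norm_def]

/-- Affine change of variable as a bounded operator on `L²(ℝ)`. -/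
noncomputable def affineCLM (c d : ℝ) (hc : c ≠ 0) : L2R →L[ℂ] L2R :=
  LinearMap.mkContinuous
    { toFun := affineComp c d hc
      map_add' := affineComp_add c d hc
      map_smul' := affineComp_smul c d hc } (|c⁻¹| ^ (1 / 2 : ℝ))
    fun f => (norm_affineComp c d hc f).le

theorem affineComp_affineComp_inv (c : ℝ) (hc : c ≠ 0) (f : L2R) :
    affineComp c⁻¹ 0 (inv_ne_zero hc) (affineComp c 0 hc f) = f := by
  apply Lp.ext
  filter_upwards [coeFn_affineComp c⁻¹ 0 (inv_ne_zero hc) (affineComp c 0 hc f),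
    (quasiMeasurePreserving_affine c⁻¹ 0 (inv_ne_zero hc)).ae (coeFn_affineComp c 0 hc f)]
    with x h1 h2
  rw [h1, h2]
  simp [hc]

theorem memLp_phaseMul {u : ℝ → ℂ} (hu : Measurable u) (hb : ∀ x, ‖u x‖ ≤ 1) (f : L2R) :
    MemLp (fun x => u x * f x) 2 volume :=
  MemLp.of_le (Lp.memLp f) (hu.aestronglyMeasurable.mul (Lp.aestronglyMeasurable f))
    (Filter.Eventually.of_forall fun x => by
      rw [norm_mul]
      exact mul_le_of_le_one_left (norm_nonneg _) (hb x))

/-- Pointwise multiplication by a function bounded by one, as an operator on `L²(ℝ)`. -/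
noncomputable def phaseMul (u : ℝ → ℂ) (hu : Measurable u) (hb : ∀ x, ‖u x‖ ≤ 1) :
    L2R →L[ℂ] L2R :=
  LinearMap.mkContinuous
    { toFun := fun f => (memLp_phaseMul hu hb f).toLp
      map_add' := fun f g => by
        apply Lp.ext
        filter_upwards [(memLp_phaseMul hu hb (f + g)).coeFn_toLp,
          (memLp_phaseMul hu hb f).coeFn_toLp, (memLp_phaseMul hu hb g).coeFn_toLp,
          Lp.coeFn_add f g, Lp.coeFn_add (memLp_phaseMul hu hb f).toLp
            (memLp_phaseMul hu hb g).toLp] with x h1 h2 h3 h4 h5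
        simp only [h1, h5, Pi.add_apply, h2, h3, h4, mul_add]
      map_smul' := fun a f => by
        apply Lp.ext
        filter_upwards [(memLp_phaseMul hu hb (a • f)).coeFn_toLp,
          (memLp_phaseMul hu hb f).coeFn_toLp, Lp.coeFn_smul a f,
          Lp.coeFn_smul a (memLp_phaseMul hu hb f).toLp] with x h1 h2 h3 h4
        simp only [h1, RingHom.id_apply, h4, Pi.smul_apply, h2, h3, smul_eq_mul]
        ring } 1
    fun f => by
      refine Lp.norm_le_mul_norm_of_ae_le_mul ?_
      filter_upwards [(memLp_phaseMul hu hb f).coeFn_toLp] with x h1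
      simp only [LinearMap.coe_mk, AddHom.coe_mk, h1, norm_mul]
      exact mul_le_mul_of_nonneg_right (hb x) (norm_nonneg _)

theorem coeFn_phaseMul {u : ℝ → ℂ} (hu : Measurable u) (hb : ∀ x, ‖u x‖ ≤ 1) (f : L2R) :
    phaseMul u hu hb f =ᵐ[volume] fun x => u x * f x :=
  (memLp_phaseMul hu hb f).coeFn_toLp

/-! ### The Fourier transform of an affine change of variable. -/

/-- The phase `exp(-2πiξd)`. -/
noncomputable def shiftPhase (d ξ : ℝ) : ℂ := Complex.exp (-(2 * Real.pi * ξ * d : ℝ) * Complex.I)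

theorem measurable_shiftPhase (d : ℝ) : Measurable (shiftPhase d) := by
  unfold shiftPhase
  fun_prop

theorem norm_shiftPhase (d ξ : ℝ) : ‖shiftPhase d ξ‖ = 1 := by
  rw [shiftPhase, ← Complex.ofReal_neg, Complex.norm_exp_ofReal_mul_I]

theorem fourier_comp_affine (c d : ℝ) (hc : c ≠ 0) (f : ℝ → ℂ) (ξ : ℝ) :
    𝓕 (fun x : ℝ => f (c * x - d)) ξ =
      ((|c⁻¹| : ℝ) : ℂ) * (shiftPhase (d / c) ξ * 𝓕 f (c⁻¹ * ξ)) := by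
  rw [Real.fourier_real_eq_integral_exp_smul, Real.fourier_real_eq_integral_exp_smul]
  -- `F` is the integrand in the variable `y = c v`; the later translation by `d` leaves only the
  -- constant phase in front.
  let F : ℝ → ℂ := fun y => shiftPhase (d / c) ξ *
    (Complex.exp (↑(-2 * Real.pi * (y - d) * (c⁻¹ * ξ)) * Complex.I) • f (y - d))
  have h : ∀ v : ℝ, Complex.exp (↑(-2 * Real.pi * v * ξ) * Complex.I) • f (c * v - d) =
      F (c * v) := by
    intro v
    simp only [F, smul_eq_mul, shiftPhase, ← mul_assoc, ← Complex.exp_add]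
    congr 2
    push_cast
    have : (c : ℂ) ≠ 0 := by exact_mod_cast hc
    field_simp
    ring
  rw [integral_congr_ae (Filter.Eventually.of_forall h), Measure.integral_comp_mul_left F c,
    integral_sub_right_eq_self (fun y => shiftPhase (d / c) ξ *
        (Complex.exp (↑(-2 * Real.pi * y * (c⁻¹ * ξ)) * Complex.I) • f y)) d,
    integral_const_mul, Complex.real_smul]

/-- Both sides are continuous in `f`, so it suffices to compare them on the dense subspace of
Schwartz functions, where the Fourier transform is an integral and `fourier_comp_affine` applies. -/
theorem fourier_affineComp_aux (c d : ℝ) (hc : c ≠ 0) (f : L2R) :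
    (𝓕 (affineComp c d hc f) : L2R) = ((|c⁻¹| : ℝ) : ℂ) •
      phaseMul (shiftPhase (d / c)) (measurable_shiftPhase _) (fun ξ => (norm_shiftPhase _ ξ).le)
        (affineComp c⁻¹ 0 (inv_ne_zero hc) (𝓕 f : L2R)) := by
  refine DenseRange.induction_on
    (p := fun f : L2R => (𝓕 (affineComp c d hc f) : L2R) = ((|c⁻¹| : ℝ) : ℂ) •
      phaseMul (shiftPhase (d / c)) (measurable_shiftPhase _) (fun ξ => (norm_shiftPhase _ ξ).le)
        (affineComp c⁻¹ 0 (inv_ne_zero hc) (𝓕 f : L2R)))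
    (SchwartzMap.denseRange_toLpCLM (E := ℝ) (F := ℂ) (μ := volume) (p := 2) ENNReal.ofNat_ne_top)
    f ?_ ?_
  · refine isClosed_eq ?_ ?_
    · exact (Lp.fourierTransformₗᵢ ℝ ℂ).continuous.comp (affineCLM c d hc).continuous
    · exact (((|c⁻¹| : ℝ) : ℂ) • (phaseMul (shiftPhase (d / c)) (measurable_shiftPhase _)
        (fun ξ => (norm_shiftPhase _ ξ).le)).comp ((affineCLM c⁻¹ 0 (inv_ne_zero hc)).comp
          (Lp.fourierTransformₗᵢ ℝ ℂ).toContinuousLinearEquiv.toContinuousLinearMap)).continuous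
  · intro s
    have hg : (fun x : ℝ => c * x - d).HasTemperateGrowth := by fun_prop
    have hanti : AntilipschitzWith ‖c⁻¹‖₊ (fun x : ℝ => c * x - d) := by
      refine AntilipschitzWith.of_le_mul_dist fun x y => ?_
      rw [coe_nnnorm, Real.dist_eq, Real.dist_eq, Real.norm_eq_abs, ← abs_mul]
      apply le_of_eq
      congr 1
      field_simp
      ring
    let s' : SchwartzMap ℝ ℂ := SchwartzMap.compCLMOfAntilipschitz ℂ hg hanti s
    have hs' : affineComp c d hc (s.toLp 2) = s'.toLp 2 := by
      apply Lp.ext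
      filter_upwards [coeFn_affineComp c d hc (s.toLp 2), s'.coeFn_toLp 2,
        (quasiMeasurePreserving_affine c d hc).ae (s.coeFn_toLp 2 volume)] with x h1 h2 h3
      rw [h1, h2, h3]
      rfl
    simp only [SchwartzMap.toLpCLM_apply]
    rw [hs', SchwartzMap.toLp_fourier_eq, SchwartzMap.toLp_fourier_eq]
    apply Lp.ext
    set g := affineComp c⁻¹ 0 (inv_ne_zero hc) ((𝓕 s).toLp 2) with hgdef
    filter_upwards [(𝓕 s').coeFn_toLp 2,
      Lp.coeFn_smul ((|c⁻¹| : ℝ) : ℂ) (phaseMul (shiftPhase (d / c)) (measurable_shiftPhase _)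
        (fun ξ => (norm_shiftPhase _ ξ).le) g),
      coeFn_phaseMul (measurable_shiftPhase (d / c)) (fun ξ => (norm_shiftPhase _ ξ).le) g,
      coeFn_affineComp c⁻¹ 0 (inv_ne_zero hc) ((𝓕 s).toLp 2),
      (quasiMeasurePreserving_affine c⁻¹ 0 (inv_ne_zero hc)).ae ((𝓕 s).coeFn_toLp 2 volume)]
      with ξ h1 h2 h3 h4 h5
    rw [h1, h2, Pi.smul_apply, h3, hgdef, h4, h5, sub_zero, smul_eq_mul, SchwartzMap.fourier_coe,
      SchwartzMap.fourier_coe]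
    exact fourier_comp_affine c d hc s ξ

/-- The Fourier transform of an affine change of variable. -/
theorem fourier_affineComp (c d : ℝ) (hc : c ≠ 0) (f : L2R) :
    (𝓕 (affineComp c d hc f) : L2R) =ᵐ[volume] fun ξ =>
      ((|c⁻¹| : ℝ) : ℂ) * (shiftPhase (d / c) ξ * (𝓕 f : L2R) (c⁻¹ * ξ)) := by
  rw [fourier_affineComp_aux]
  set g := affineComp c⁻¹ 0 (inv_ne_zero hc) (𝓕 f : L2R) with hgdef
  filter_upwards [Lp.coeFn_smul ((|c⁻¹| : ℝ) : ℂ) (phaseMul (shiftPhase (d / c))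
        (measurable_shiftPhase _) (fun ξ => (norm_shiftPhase _ ξ).le) g),
      coeFn_phaseMul (measurable_shiftPhase (d / c)) (fun ξ => (norm_shiftPhase _ ξ).le) g,
      coeFn_affineComp c⁻¹ 0 (inv_ne_zero hc) (𝓕 f : L2R)] with ξ h2 h3 h4
  rw [h2, Pi.smul_apply, h3, hgdef, h4, sub_zero, smul_eq_mul]

theorem L2R.ext_fourier {f g : L2R} (h : (𝓕 f : L2R) =ᵐ[volume] (𝓕 g : L2R)) : f = g :=
  (Lp.fourierTransformₗᵢ ℝ ℂ).injective (Lp.ext h)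

theorem ae_ne_zero : ∀ᵐ ξ : ℝ, ξ ≠ 0 :=
  Measure.ae_ne volume 0

/-! ### The fractional Hilbert transform as a unimodular multiplier. -/

/-- The Fourier multiplier `exp(iπτ sign ξ)` of the fractional Hilbert transform. -/
noncomputable def fHTPhase (τ ξ : ℝ) : ℂ :=
  Complex.exp ((Real.pi * τ * (SignType.sign ξ : ℝ) : ℝ) * Complex.I)

theorem norm_fHTPhase (τ ξ : ℝ) : ‖fHTPhase τ ξ‖ = 1 := by
  rw [fHTPhase, Complex.norm_exp_ofReal_mul_I]

theorem fHTPhase_mul_of_pos (τ : ℝ) {c : ℝ} (hc : 0 < c) (ξ : ℝ) :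
    fHTPhase τ (c * ξ) = fHTPhase τ ξ := by
  rw [fHTPhase, fHTPhase, sign_mul, sign_pos hc, one_mul]

/-- Euler's formula with `sign ξ = ±1`. At `ξ = 0` the two sides are `1` and `cos(πτ)`, which is
harmless almost everywhere. -/
theorem fHTPhase_of_ne_zero (τ : ℝ) {ξ : ℝ} (hξ : ξ ≠ 0) :
    fHTPhase τ ξ = Real.cos (Real.pi * τ) -
      Real.sin (Real.pi * τ) * (-Complex.I * ((SignType.sign ξ : ℝ) : ℂ)) := by
  rcases hξ.lt_or_gt with h | h
  · rw [fHTPhase, sign_neg h, Complex.exp_mul_I, ← Complex.ofReal_cos, ← Complex.ofReal_sin]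
    simp [sub_eq_add_neg]
  · rw [fHTPhase, sign_pos h, Complex.exp_mul_I, ← Complex.ofReal_cos, ← Complex.ofReal_sin]
    simp

theorem fourier_hilbertTransform (f : L2R) :
    (𝓕 (hilbertTransform f) : L2R) =ᵐ[volume]
      fun ξ => -Complex.I * ((SignType.sign ξ : ℝ) : ℂ) * (𝓕 f : L2R) ξ := by
  rw [hilbertTransform, FourierTransform.fourier_fourierInv_eq]
  exact (memLp_hilbert f).coeFn_toLp

theorem fourier_fHT (τ : ℝ) (f : L2R) :
    (𝓕 (fHT τ f) : L2R) =ᵐ[volume] fun ξ => fHTPhase τ ξ * (𝓕 f : L2R) ξ := by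
  have h : (𝓕 (fHT τ f) : L2R) = ((Real.cos (Real.pi * τ) : ℝ) : ℂ) • (𝓕 f : L2R) -
      ((Real.sin (Real.pi * τ) : ℝ) : ℂ) • (𝓕 (hilbertTransform f) : L2R) := by
    change Lp.fourierTransformₗᵢ ℝ ℂ _ = _
    rw [fHT, map_sub, map_smul, map_smul]
    rfl
  rw [h]
  filter_upwards [Lp.coeFn_sub (((Real.cos (Real.pi * τ) : ℝ) : ℂ) • (𝓕 f : L2R))
      (((Real.sin (Real.pi * τ) : ℝ) : ℂ) • (𝓕 (hilbertTransform f) : L2R)),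
    Lp.coeFn_smul ((Real.cos (Real.pi * τ) : ℝ) : ℂ) (𝓕 f : L2R),
    Lp.coeFn_smul ((Real.sin (Real.pi * τ) : ℝ) : ℂ) (𝓕 (hilbertTransform f) : L2R),
    fourier_hilbertTransform f, ae_ne_zero] with ξ h1 h2 h3 h4 h5
  rw [h1, Pi.sub_apply, h2, h3, Pi.smul_apply, Pi.smul_apply, h4, fHTPhase_of_ne_zero τ h5,
    smul_eq_mul, smul_eq_mul]
  ring

theorem inner_fHT (τ : ℝ) (f g : L2R) : inner ℂ (fHT τ f) (fHT τ g) = inner ℂ f g := by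
  rw [← Lp.inner_fourier_eq (fHT τ f), ← Lp.inner_fourier_eq f, L2.inner_def, L2.inner_def]
  refine integral_congr_ae ?_
  filter_upwards [fourier_fHT τ f, fourier_fHT τ g] with ξ h1 h2
  rw [h1, h2, RCLike.inner_apply, RCLike.inner_apply, map_mul]
  have : fHTPhase τ ξ * (starRingEnd ℂ) (fHTPhase τ ξ) = 1 := by
    rw [Complex.mul_conj, Complex.normSq_eq_norm_sq, norm_fHTPhase]
    norm_num
  linear_combination (𝓕 g : L2R) ξ * (starRingEnd ℂ) ((𝓕 f : L2R) ξ) * this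

/-- The translation acts as a phase, which commutes with any multiplier, and a dilation by `c > 0`
does not change the sign of a frequency. -/
theorem fHT_affineComp (τ : ℝ) {c : ℝ} (d : ℝ) (hc : 0 < c) (f : L2R) :
    fHT τ (affineComp c d hc.ne' f) = affineComp c d hc.ne' (fHT τ f) := by
  apply L2R.ext_fourier
  have hq := quasiMeasurePreserving_affine c⁻¹ 0 (inv_ne_zero hc.ne')
  filter_upwards [fourier_fHT τ (affineComp c d hc.ne' f), fourier_affineComp c d hc.ne' f,
    fourier_affineComp c d hc.ne' (fHT τ f), hq.ae (fourier_fHT τ f)] with ξ h1 h2 h3 h4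
  rw [sub_zero] at h4
  rw [h1, h2, h3, h4, fHTPhase_mul_of_pos τ (inv_pos.mpr hc)]
  ring

theorem fHT_smul (τ : ℝ) (a : ℂ) (f : L2R) : fHT τ (a • f) = a • fHT τ f := by
  apply L2R.ext_fourier
  have h (a : ℂ) (g : L2R) : (𝓕 (a • g) : L2R) = a • (𝓕 g : L2R) :=
    (Lp.fourierTransformₗᵢ ℝ ℂ).map_smul a g
  have h1 := fourier_fHT τ (a • f)
  rw [h] at h1 ⊢
  filter_upwards [h1, fourier_fHT τ f, Lp.coeFn_smul a (𝓕 f : L2R),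
    Lp.coeFn_smul a (𝓕 (fHT τ f) : L2R)] with ξ h1 h2 h3 h4
  rw [h1, h3, h4, Pi.smul_apply, Pi.smul_apply, h2, smul_eq_mul, smul_eq_mul]
  ring

theorem fHT_dyadic (τ : ℝ) (p : ℤ × ℤ) (ψ : L2R) :
    fHT τ (dyadic p ψ) = dyadic p (fHT τ ψ) := by
  rw [dyadic, dyadic, fHT_smul, fHT_affineComp τ _ (zpow_pos two_pos p.1)]

theorem inner_dyadic_fHT (τ : ℝ) (p q : ℤ × ℤ) (ψ ψ' : L2R) :
    inner ℂ (dyadic p (fHT τ ψ)) (dyadic q (fHT τ ψ')) = inner ℂ (dyadic p ψ) (dyadic q ψ') := by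
  rw [← fHT_dyadic, ← fHT_dyadic, inner_fHT]

theorem IsOrthonormalWavelet.fHT {ψ : L2R} (h : IsOrthonormalWavelet ψ) (τ : ℝ) :
    IsOrthonormalWavelet (fHT τ ψ) := by
  rw [IsOrthonormalWavelet, orthonormal_iff_ite] at h ⊢
  exact fun p q => (inner_dyadic_fHT τ p q ψ ψ).trans (h p q)

theorem IsSemiorthogonalWavelet.fHT {ψ : L2R} (h : IsSemiorthogonalWavelet ψ) (τ : ℝ) :
    IsSemiorthogonalWavelet (fHT τ ψ) :=
  fun p q hpq => (inner_dyadic_fHT τ p q ψ ψ).trans (h p q hpq)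

theorem IsDualPair.fHT {ψ ψ' : L2R} (h : IsDualPair ψ ψ') (τ : ℝ) :
    IsDualPair (fHT τ ψ) (fHT τ ψ') :=
  fun p q => (inner_dyadic_fHT τ p q ψ ψ').trans (h p q)

/-! ### Periodisation: from the line to the circle. -/

theorem lintegral_eq_setLIntegral_tsum_int {F : ℝ → ℝ≥0∞} (hF : Measurable F) (a : ℝ) :
    ∫⁻ ξ, F ξ = ∫⁻ ξ in Set.Ioc a (a + 1), ∑' k : ℤ, F (ξ + k) := by
  have hU : (⋃ k : ℤ, Set.Ioc (a + k) (a + k + 1)) = Set.univ := iUnion_Ioc_add_intCast a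
  have hD : Pairwise (Function.onFun Disjoint fun k : ℤ => Set.Ioc (a + k) (a + k + 1)) :=
    Set.pairwise_disjoint_Ioc_add_intCast a
  rw [← setLIntegral_univ, ← hU, lintegral_iUnion (fun _ => measurableSet_Ioc) hD,
    lintegral_tsum (fun k => by fun_prop)]
  refine tsum_congr fun k => ?_
  have h := (measurePreserving_add_right volume (k : ℝ)).setLIntegral_comp_preimage
    (measurableSet_Ioc (a := a + k) (b := a + k + 1)) hF
  rw [← h]
  congr 2
  ext x
  simp only [Set.mem_preimage, Set.mem_Ioc]
  constructor <;> rintro ⟨h1, h2⟩ <;> constructor <;> linarith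

/-- The push-forward of `w(ξ) dξ` to the circle. -/
theorem map_withDensity_apply {w : ℝ → ℝ≥0∞} (hw : Measurable w) (a : ℝ) {s : Set UnitAddCircle}
    (hs : MeasurableSet s) :
    (volume.withDensity w).map ((↑) : ℝ → UnitAddCircle) s =
      ∫⁻ ξ in Set.Ioc a (a + 1), s.indicator 1 (ξ : UnitAddCircle) * ∑' k : ℤ, w (ξ + k) := by
  have hmk : Measurable ((↑) : ℝ → UnitAddCircle) := AddCircle.measurable_mk'
  rw [Measure.map_apply hmk hs, withDensity_apply _ (hmk hs), ← lintegral_indicator (hmk hs),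
    lintegral_eq_setLIntegral_tsum_int (hw.indicator (hmk hs)) a]
  refine lintegral_congr fun ξ => ?_
  rw [← ENNReal.tsum_mul_left]
  refine tsum_congr fun k => ?_
  have hk : ((ξ + k : ℝ) : UnitAddCircle) = ξ := by
    rw [AddCircle.coe_add, add_eq_left, AddCircle.coe_eq_zero_iff]
    exact ⟨k, by simp⟩
  by_cases h : (ξ : UnitAddCircle) ∈ s
  · rw [Set.indicator_of_mem h, Set.indicator_of_mem (by rwa [Set.mem_preimage, hk]), Pi.one_apply,
      one_mul]
  · rw [Set.indicator_of_notMem h, Set.indicator_of_notMem (by rwa [Set.mem_preimage, hk]),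
      zero_mul]

theorem volume_unitAddCircle_apply (a : ℝ) {s : Set UnitAddCircle} (hs : MeasurableSet s) :
    volume s = ∫⁻ ξ in Set.Ioc a (a + 1), s.indicator 1 (ξ : UnitAddCircle) := by
  rw [UnitAddCircle.lintegral_preimage a (s.indicator 1), lintegral_indicator_one hs]

theorem map_withDensity_le {w : ℝ → ℝ≥0∞} (hw : Measurable w) (a : ℝ) {C : ℝ≥0∞}
    (hC : ∀ ξ ∈ Set.Ioc a (a + 1), ∑' k : ℤ, w (ξ + k) ≤ C) :
    (volume.withDensity w).map ((↑) : ℝ → UnitAddCircle) ≤ C • volume := by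
  refine Measure.le_iff.mpr fun s hs => ?_
  have hm : Measurable fun ξ : ℝ => s.indicator (1 : UnitAddCircle → ℝ≥0∞) (ξ : UnitAddCircle) :=
    (measurable_one.indicator hs).comp AddCircle.measurable_mk'
  rw [map_withDensity_apply hw a hs, Measure.smul_apply, volume_unitAddCircle_apply a hs,
    smul_eq_mul, ← lintegral_const_mul _ hm]
  refine setLIntegral_mono' measurableSet_Ioc fun ξ hξ => ?_
  rw [mul_comm]
  gcongr
  exact hC ξ hξ

/-- The equality case of `map_withDensity_le`: it turns integrals over the line into integrals over
the circle in the proof of biorthogonality. -/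
theorem map_withDensity_eq {w : ℝ → ℝ≥0∞} (hw : Measurable w) (a : ℝ)
    (hC : ∀ ξ ∈ Set.Ioc a (a + 1), ∑' k : ℤ, w (ξ + k) = 1) :
    (volume.withDensity w).map ((↑) : ℝ → UnitAddCircle) = volume := by
  ext s hs
  rw [map_withDensity_apply hw a hs, volume_unitAddCircle_apply a hs]
  exact setLIntegral_congr_fun measurableSet_Ioc fun ξ hξ => by simp only [hC ξ hξ, mul_one]

theorem quasiMeasurePreserving_mk_volume :
    Measure.QuasiMeasurePreserving ((↑) : ℝ → UnitAddCircle) volume volume := by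
  refine ⟨AddCircle.measurable_mk', Measure.AbsolutelyContinuous.mk fun s hs h0 => ?_⟩
  have hm : Measurable fun ξ : ℝ => s.indicator (1 : UnitAddCircle → ℝ≥0∞) (ξ : UnitAddCircle) :=
    (measurable_one.indicator hs).comp AddCircle.measurable_mk'
  have h := map_withDensity_apply (w := 1) measurable_one 0 hs
  rw [withDensity_one] at h
  rw [h]
  rw [volume_unitAddCircle_apply 0 hs, lintegral_eq_zero_iff hm] at h0
  refine (lintegral_congr_ae ?_).trans lintegral_zero
  filter_upwards [h0] with ξ hξ
  simp only [Pi.zero_apply] at hξ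
  simp [hξ]

theorem haarAddCircle_eq_volume :
    (AddCircle.haarAddCircle : Measure UnitAddCircle) = volume := by
  rw [AddCircle.volume_eq_smul_haarAddCircle, ENNReal.ofReal_one, one_smul]

theorem quasiMeasurePreserving_mk_unitAddCircle :
    Measure.QuasiMeasurePreserving ((↑) : ℝ → UnitAddCircle) volume AddCircle.haarAddCircle := by
  rw [haarAddCircle_eq_volume]
  exact quasiMeasurePreserving_mk_volume

/-- The left side is the norm of `p` with respect to the push-forward of `|m|² dξ` to the circle, a
measure dominated by `C` times Haar measure. -/
theorem eLpNorm_comp_mk_mul_le {m : ℝ → ℂ} (hm : Measurable m) (a : ℝ) {C : ℝ≥0∞}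
    (hC : ∀ ξ ∈ Set.Ioc a (a + 1), ∑' k : ℤ, ‖m (ξ + k)‖ₑ ^ 2 ≤ C) {p : UnitAddCircle → ℂ}
    (hp : AEStronglyMeasurable p AddCircle.haarAddCircle) :
    eLpNorm (fun ξ : ℝ => p ξ * m ξ) 2 volume ≤
      C ^ (1 / 2 : ℝ) * eLpNorm p 2 AddCircle.haarAddCircle := by
  rw [haarAddCircle_eq_volume] at hp ⊢
  have hw : Measurable fun ξ => ‖m ξ‖ₑ ^ 2 := by fun_prop
  have hle := map_withDensity_le hw a hC
  have hpm : AEStronglyMeasurable (fun ξ : ℝ => p ξ) volume :=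
    hp.comp_quasiMeasurePreserving quasiMeasurePreserving_mk_volume
  have hpm' : AEMeasurable (fun ξ : ℝ => ‖p ξ‖ₑ ^ (2 : ℝ≥0∞).toReal) volume :=
    hpm.enorm.pow_const _
  calc eLpNorm (fun ξ : ℝ => p ξ * m ξ) 2 volume
      = eLpNorm (p ∘ ((↑) : ℝ → UnitAddCircle)) 2 (volume.withDensity fun ξ => ‖m ξ‖ₑ ^ 2) := by
        rw [eLpNorm_eq_lintegral_rpow_enorm_toReal two_ne_zero ENNReal.ofNat_ne_top,
          eLpNorm_eq_lintegral_rpow_enorm_toReal two_ne_zero ENNReal.ofNat_ne_top,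
          show (fun x => ‖(p ∘ ((↑) : ℝ → UnitAddCircle)) x‖ₑ ^ (2 : ℝ≥0∞).toReal) =
            fun x : ℝ => ‖p x‖ₑ ^ (2 : ℝ≥0∞).toReal from rfl,
          lintegral_withDensity_eq_lintegral_mul₀ hw.aemeasurable hpm']
        congr 1
        refine lintegral_congr fun ξ => ?_
        simp [enorm_mul, mul_pow, mul_comm]
    _ = eLpNorm p 2 ((volume.withDensity fun ξ => ‖m ξ‖ₑ ^ 2).map (↑)) :=
        (eLpNorm_map_measure (hp.mono_ac (Measure.absolutelyContinuous_of_le_smul hle))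
          AddCircle.measurable_mk'.aemeasurable).symm
    _ ≤ eLpNorm p 2 (C • volume) := eLpNorm_mono_measure _ hle
    _ = C ^ (1 / 2 : ℝ) * eLpNorm p 2 volume := by
        rw [eLpNorm_smul_measure_of_ne_top (by simp)]
        simp

theorem memLp_comp_mk_mul {m : ℝ → ℂ} (hm : Measurable m) (a : ℝ) {C : ℝ≥0∞} (hC' : C ≠ ⊤)
    (hC : ∀ ξ ∈ Set.Ioc a (a + 1), ∑' k : ℤ, ‖m (ξ + k)‖ₑ ^ 2 ≤ C) {p : UnitAddCircle → ℂ}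
    (hp : MemLp p 2 AddCircle.haarAddCircle) :
    MemLp (fun ξ : ℝ => p ξ * m ξ) 2 volume := by
  refine ⟨?_, (eLpNorm_comp_mk_mul_le hm a hC hp.1).trans_lt ?_⟩
  · exact (hp.1.comp_quasiMeasurePreserving quasiMeasurePreserving_mk_unitAddCircle).mul
      hm.aestronglyMeasurable
  · exact ENNReal.mul_lt_top (ENNReal.rpow_lt_top_of_nonneg (by norm_num) hC') hp.2

/-- Synthesis in the Fourier domain: multiplication of a `1`-periodic function by a fixed function
with bounded periodised square. -/
noncomputable def synthesisCLM {m : ℝ → ℂ} (hm : Measurable m) (a : ℝ) {C : ℝ≥0∞} (hC' : C ≠ ⊤)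
    (hC : ∀ ξ ∈ Set.Ioc a (a + 1), ∑' k : ℤ, ‖m (ξ + k)‖ₑ ^ 2 ≤ C) :
    Lp ℂ 2 (AddCircle.haarAddCircle : Measure UnitAddCircle) →L[ℂ] L2R :=
  LinearMap.mkContinuous
    { toFun := fun p => (memLp_comp_mk_mul hm a hC' hC (Lp.memLp p)).toLp
      map_add' := fun p q => by
        apply Lp.ext
        filter_upwards [(memLp_comp_mk_mul hm a hC' hC (Lp.memLp (p + q))).coeFn_toLp,
          (memLp_comp_mk_mul hm a hC' hC (Lp.memLp p)).coeFn_toLp,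
          (memLp_comp_mk_mul hm a hC' hC (Lp.memLp q)).coeFn_toLp,
          quasiMeasurePreserving_mk_unitAddCircle.ae (Lp.coeFn_add p q),
          Lp.coeFn_add (memLp_comp_mk_mul hm a hC' hC (Lp.memLp p)).toLp
            (memLp_comp_mk_mul hm a hC' hC (Lp.memLp q)).toLp] with x h1 h2 h3 h4 h5
        simp only [h1, h5, Pi.add_apply, h2, h3, h4, add_mul]
      map_smul' := fun b p => by
        apply Lp.ext
        filter_upwards [(memLp_comp_mk_mul hm a hC' hC (Lp.memLp (b • p))).coeFn_toLp,
          (memLp_comp_mk_mul hm a hC' hC (Lp.memLp p)).coeFn_toLp,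
          quasiMeasurePreserving_mk_unitAddCircle.ae (Lp.coeFn_smul b p),
          Lp.coeFn_smul b (memLp_comp_mk_mul hm a hC' hC (Lp.memLp p)).toLp] with x h1 h2 h3 h4
        simp only [h1, RingHom.id_apply, h4, Pi.smul_apply, h2, h3, smul_eq_mul]
        ring } (C ^ (1 / 2 : ℝ)).toReal
    fun p => by
      simp only [LinearMap.coe_mk, AddHom.coe_mk]
      rw [Lp.norm_toLp, Lp.norm_def, ← ENNReal.toReal_mul]
      refine ENNReal.toReal_mono (ENNReal.mul_ne_top
        (ENNReal.rpow_ne_top_of_nonneg (by norm_num) hC') (Lp.eLpNorm_ne_top p))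
        (eLpNorm_comp_mk_mul_le hm a hC (Lp.aestronglyMeasurable p))

theorem coeFn_synthesisCLM {m : ℝ → ℂ} (hm : Measurable m) (a : ℝ) {C : ℝ≥0∞} (hC' : C ≠ ⊤)
    (hC : ∀ ξ ∈ Set.Ioc a (a + 1), ∑' k : ℤ, ‖m (ξ + k)‖ₑ ^ 2 ≤ C)
    (p : Lp ℂ 2 (AddCircle.haarAddCircle : Measure UnitAddCircle)) :
    synthesisCLM hm a hC' hC p =ᵐ[volume] fun ξ : ℝ => p (ξ : UnitAddCircle) * m ξ :=
  (memLp_comp_mk_mul hm a hC' hC (Lp.memLp p)).coeFn_toLp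

theorem fourier_intTranslate (k : ℤ) (φ : L2R) :
    (𝓕 (intTranslate k φ) : L2R) =ᵐ[volume]
      fun ξ => fourier (-k) (ξ : UnitAddCircle) * (𝓕 φ : L2R) ξ := by
  filter_upwards [fourier_affineComp 1 k one_ne_zero φ] with ξ h
  rw [intTranslate, h, fourier_coe_apply, shiftPhase]
  simp only [inv_one, abs_one, Complex.ofReal_one, one_mul, div_one]
  congr 2
  push_cast
  ring

/-- The series `∑ₖ p̂(-k) φ(x - k)` converges, and its sum has Fourier transform `p φ̂`. -/
theorem exists_hasSum_intTranslate {m : ℝ → ℂ} (hm : Measurable m) (a : ℝ) {C : ℝ≥0∞}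
    (hC' : C ≠ ⊤) (hC : ∀ ξ ∈ Set.Ioc a (a + 1), ∑' k : ℤ, ‖m (ξ + k)‖ₑ ^ 2 ≤ C)
    {φ : L2R} (hφ : (𝓕 φ : L2R) =ᵐ[volume] m) {p : UnitAddCircle → ℂ} (hp : MemLp p 2 volume) :
    ∃ S : L2R, HasSum (fun k : ℤ => fourierCoeff p (-k) • intTranslate k φ) S ∧
      (𝓕 S : L2R) =ᵐ[volume] fun ξ : ℝ => p ξ * m ξ := by
  rw [← haarAddCircle_eq_volume] at hp
  have hp' := hp.coeFn_toLp
  set q := hp.toLp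
  have hcoef : fourierCoeff q = fourierCoeff p := fourierCoeff_congr_ae hp'
  let e := (Lp.fourierTransformₗᵢ ℝ ℂ).symm.toContinuousLinearEquiv.toContinuousLinearMap
  refine ⟨e (synthesisCLM hm a hC' hC q), ?_, ?_⟩
  · have h := ((e.comp (synthesisCLM hm a hC' hC)).hasSum (hasSum_fourier_series_L2 q))
    -- Translation by `k` corresponds to the character of index `-k`, so the Fourier series is
    -- summed in the reversed order.
    rw [← (Equiv.neg ℤ).hasSum_iff] at h
    convert! h using 2 with k
    simp only [Function.comp_apply, Equiv.neg_apply, map_smul, hcoef]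
    congr 1
    apply L2R.ext_fourier
    have h2 : (𝓕 (e (synthesisCLM hm a hC' hC (fourierLp 2 (-k)))) : L2R) = synthesisCLM hm a hC' hC
        (fourierLp 2 (-k)) :=
      (Lp.fourierTransformₗᵢ ℝ ℂ).apply_symm_apply _
    change _ =ᵐ[volume] (𝓕 (e (synthesisCLM hm a hC' hC (fourierLp 2 (-k)))) : L2R)
    rw [h2]
    filter_upwards [fourier_intTranslate k φ, hφ, coeFn_synthesisCLM hm a hC' hC
      (fourierLp 2 (-k)),
      quasiMeasurePreserving_mk_unitAddCircle.ae (coeFn_fourierLp 2 (-k))] with ξ h3 h4 h5 h6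
    rw [h3, h5, h6, h4]
  · have h2 : (𝓕 (e (synthesisCLM hm a hC' hC q)) : L2R) = synthesisCLM hm a hC' hC q :=
      (Lp.fourierTransformₗᵢ ℝ ℂ).apply_symm_apply _
    rw [h2]
    filter_upwards [coeFn_synthesisCLM hm a hC' hC q,
      quasiMeasurePreserving_mk_unitAddCircle.ae hp'] with ξ h3 h4
    rw [h3, h4]

/-! ### Moduli of B-splines and bounds on the Gram function. -/

theorem norm_bsplineBase (ω : ℝ) : ‖bsplineBase ω‖ = |Real.sinc (ω / 2)| := by
  rcases eq_or_ne ω 0 with rfl | h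
  · simp [bsplineBase]
  · have h2 : Complex.exp (-(Complex.I * ω)) = Complex.exp (Complex.I * ((-ω : ℝ) : ℂ)) := by
      congr 1
      push_cast
      ring
    rw [bsplineBase, if_neg h, norm_div, norm_sub_rev, h2, Complex.norm_exp_I_mul_ofReal_sub_one,
      Real.sinc_of_ne_zero (by positivity), norm_mul, norm_mul, Complex.norm_I, one_mul,
      Complex.norm_real, neg_div, Real.sin_neg, abs_div, abs_div, norm_neg, Real.norm_two, abs_two,
      Real.norm_eq_abs, Real.norm_eq_abs]
    field_simp

theorem bsplineBase_neg (ω : ℝ) : bsplineBase (-ω) = (starRingEnd ℂ) (bsplineBase ω) := by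
  rcases eq_or_ne ω 0 with rfl | h
  · simp [bsplineBase]
  · rw [bsplineBase, bsplineBase, if_neg h, if_neg (neg_ne_zero.mpr h), map_div₀, map_sub,
      ← Complex.exp_conj, map_neg, map_mul, map_one, Complex.conj_I, Complex.conj_ofReal]
    simp

theorem measurable_bsplineBase : Measurable bsplineBase := by
  unfold bsplineBase
  exact Measurable.ite (measurableSet_singleton 0) measurable_const (by fun_prop)

theorem measurable_bsplineFT (α τ : ℝ) : Measurable (bsplineFT α τ) := by
  unfold bsplineFT
  exact (measurable_bsplineBase.pow_const _).mul
    ((measurable_bsplineBase.comp measurable_neg).pow_const _)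

/-- The modulus of a product `x ^ a * y ^ b` with `‖x‖ = ‖y‖` and real exponents. -/
theorem norm_cpow_mul_cpow {x y : ℂ} (hxy : ‖x‖ = ‖y‖) {a b : ℝ} (hab : 0 < a + b) :
    ‖x ^ (a : ℂ) * y ^ (b : ℂ)‖ = ‖x‖ ^ (a + b) := by
  rw [norm_mul, Complex.norm_cpow_real, Complex.norm_cpow_real, ← hxy]
  -- When both bases vanish, `0 ^ 0 = 1` cannot occur in both factors, because `a + b > 0`.
  rcases (norm_nonneg x).eq_or_lt with h | h
  · rw [← h, Real.zero_rpow hab.ne']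
    rcases eq_or_ne a 0 with ha | ha
    · rw [Real.zero_rpow (x := b) (by rintro rfl; simp [ha] at hab), mul_zero]
    · rw [Real.zero_rpow ha, zero_mul]
  · rw [Real.rpow_add h]

theorem norm_bsplineFT {α : ℝ} (hα : 0 ≤ α) (τ ω : ℝ) :
    ‖bsplineFT α τ ω‖ = |Real.sinc (ω / 2)| ^ (α + 1) := by
  rw [bsplineFT, norm_cpow_mul_cpow, norm_bsplineBase]
  · congr 1
    ring
  · rw [bsplineBase_neg, Complex.norm_conj]
  · linarith

theorem bsplineGram_add_int (α τ ω : ℝ) (k : ℤ) :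
    bsplineGram α τ (ω + 2 * Real.pi * k) = bsplineGram α τ ω := by
  rw [bsplineGram, bsplineGram,
    ← (Equiv.addLeft k).tsum_eq fun j : ℤ => ‖bsplineFT α τ (ω + 2 * Real.pi * j)‖ ^ 2]
  refine tsum_congr fun j => ?_
  simp only [Equiv.coe_addLeft, Int.cast_add]
  ring_nf

theorem bsplineGram_eq {α : ℝ} (hα : 0 ≤ α) (τ τ' ω : ℝ) :
    bsplineGram α τ ω = bsplineGram α τ' ω := by
  simp only [bsplineGram, norm_bsplineFT hα]

theorem measurable_bsplineGram (α τ : ℝ) : Measurable (bsplineGram α τ) := by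
  unfold bsplineGram
  have := measurable_bsplineFT α τ
  exact Measurable.tsum (fun k => by fun_prop)

theorem measurable_dualBsplineFT (α τ : ℝ) : Measurable (dualBsplineFT α τ) :=
  (measurable_bsplineFT α τ).div (Complex.measurable_ofReal.comp (measurable_bsplineGram α τ))

theorem norm_bsplineFT_le_abs_sinc {α : ℝ} (hα : 0 ≤ α) (τ ω : ℝ) :
    ‖bsplineFT α τ ω‖ ≤ |Real.sinc (ω / 2)| := by
  rw [norm_bsplineFT hα]
  calc |Real.sinc (ω / 2)| ^ (α + 1) ≤ |Real.sinc (ω / 2)| ^ (1 : ℝ) :=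
        Real.rpow_le_rpow_of_exponent_ge' (abs_nonneg _) (Real.abs_sinc_le_one _) zero_le_one
          (by linarith)
    _ = _ := Real.rpow_one _

theorem abs_sinc_sq_le (x : ℝ) : |Real.sinc x| ^ 2 * x ^ 2 ≤ 1 := by
  rcases eq_or_ne x 0 with rfl | h
  · simp
  · rw [sq_abs, Real.sinc_of_ne_zero h, div_pow, div_mul_cancel₀ _ (by positivity)]
    exact Real.sin_sq_le_one x

/-- A summable majorant, uniform over one period. The offset `1 / 2` keeps the denominator away from
zero for every `k`, including `k = 0`. -/
theorem norm_bsplineFT_sq_le {α : ℝ} (hα : 0 ≤ α) (τ : ℝ) {ξ : ℝ}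
    (hξ : ξ ∈ Set.Ioc (-1 / 2 : ℝ) (-1 / 2 + 1)) (k : ℤ) :
    ‖bsplineFT α τ (2 * Real.pi * (ξ + k))‖ ^ 2 ≤ 4 * (1 / |(k : ℝ) + 1 / 2| ^ (2 : ℝ)) := by
  have h1 : ‖bsplineFT α τ (2 * Real.pi * (ξ + k))‖ ^ 2 ≤ |Real.sinc (Real.pi * (ξ + k))| ^ 2 := by
    have := norm_bsplineFT_le_abs_sinc hα τ (2 * Real.pi * (ξ + k))
    rw [mul_assoc, mul_div_cancel_left₀ _ two_ne_zero, ← mul_assoc] at this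
    gcongr
  refine h1.trans ?_
  have hk : (k : ℝ) + 1 / 2 ≠ 0 := by
    intro h
    have h' : ((2 * k + 1 : ℤ) : ℝ) = 0 := by push_cast; linarith
    have := Int.cast_eq_zero.mp h'
    omega
  have h0 : |Real.sinc (Real.pi * (ξ + k))| ^ 2 ≤ 1 :=
    pow_le_one₀ (abs_nonneg _) (Real.abs_sinc_le_one _)
  have h2 := abs_sinc_sq_le (Real.pi * (ξ + k))
  have h3 : |Real.sinc (Real.pi * (ξ + k))| ^ 2 * (ξ + k) ^ 2 ≤ 1 := by
    refine le_trans ?_ h2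
    rw [mul_pow]
    gcongr
    exact le_mul_of_one_le_left (sq_nonneg _) (one_le_pow₀ (by linarith [Real.pi_gt_three]))
  rw [Real.rpow_two, sq_abs ((k : ℝ) + 1 / 2), mul_one_div, le_div_iff₀ (by positivity)]
  -- Write `k + 1/2 = (ξ + k) - (ξ - 1/2)` with `|ξ - 1/2| < 1` and use `(a - b)² ≤ 2a² + 2b²`.
  -- Multiplied by `sinc²`, each of the two terms is at most `2`, whence the constant `4`.
  have h4 : ((k : ℝ) + 1 / 2) ^ 2 ≤ 2 * (ξ + k) ^ 2 + 2 := by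
    nlinarith [sq_nonneg ((ξ + k) + (ξ - 1 / 2)), hξ.1, hξ.2]
  nlinarith [sq_nonneg |Real.sinc (Real.pi * (ξ + k))|]

theorem summable_bound_gram : Summable fun k : ℤ => 4 * (1 / |(k : ℝ) + 1 / 2| ^ (2 : ℝ)) :=
  ((Real.summable_one_div_int_add_rpow (1 / 2) 2).mpr one_lt_two).mul_left 4

theorem summable_norm_bsplineFT_sq {α : ℝ} (hα : 0 ≤ α) (τ : ℝ) {ξ : ℝ}
    (hξ : ξ ∈ Set.Ioc (-1 / 2 : ℝ) (-1 / 2 + 1)) :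
    Summable fun k : ℤ => ‖bsplineFT α τ (2 * Real.pi * (ξ + k))‖ ^ 2 :=
  Summable.of_nonneg_of_le (fun _ => sq_nonneg _) (norm_bsplineFT_sq_le hα τ hξ)
    summable_bound_gram

theorem bsplineGram_two_pi_mul (α τ ξ : ℝ) :
    bsplineGram α τ (2 * Real.pi * ξ) =
      ∑' k : ℤ, ‖bsplineFT α τ (2 * Real.pi * (ξ + k))‖ ^ 2 := by
  simp only [bsplineGram, mul_add]

theorem bsplineGram_le {α : ℝ} (hα : 0 ≤ α) (τ : ℝ) {ξ : ℝ}
    (hξ : ξ ∈ Set.Ioc (-1 / 2 : ℝ) (-1 / 2 + 1)) :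
    bsplineGram α τ (2 * Real.pi * ξ) ≤ ∑' k : ℤ, 4 * (1 / |(k : ℝ) + 1 / 2| ^ (2 : ℝ)) := by
  rw [bsplineGram_two_pi_mul]
  exact (summable_norm_bsplineFT_sq hα τ hξ).tsum_le_tsum (norm_bsplineFT_sq_le hα τ hξ)
    summable_bound_gram

/-- Jordan's inequality `sin y ≥ (2/π) y`, weakened by `π ≤ 4`. -/
theorem half_le_sinc {x : ℝ} (hx : |x| ≤ Real.pi / 2) : 1 / 2 ≤ Real.sinc x := by
  have key : ∀ y : ℝ, 0 < y → y ≤ Real.pi / 2 → 1 / 2 ≤ Real.sinc y := by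
    intro y h0 h1
    have h := Real.mul_le_sin h0.le h1
    rw [Real.sinc_of_ne_zero h0.ne', le_div_iff₀ h0]
    refine le_trans ?_ h
    refine mul_le_mul_of_nonneg_right ?_ h0.le
    rw [div_le_div_iff₀ two_pos Real.pi_pos]
    linarith [Real.pi_le_four]
  rcases lt_trichotomy x 0 with h | rfl | h
  · rw [← Real.sinc_neg]
    exact key _ (by linarith) (by linarith [neg_abs_le x])
  · norm_num
  · exact key _ h (by linarith [le_abs_self x])

/-- The term `k = 0` alone suffices, since `|πξ| ≤ π/2` on this period. -/
theorem le_bsplineGram {α : ℝ} (hα : 0 ≤ α) (τ : ℝ) {ξ : ℝ}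
    (hξ : ξ ∈ Set.Ioc (-1 / 2 : ℝ) (-1 / 2 + 1)) :
    ((1 / 2 : ℝ) ^ (α + 1)) ^ 2 ≤ bsplineGram α τ (2 * Real.pi * ξ) := by
  rw [bsplineGram_two_pi_mul]
  refine le_trans ?_ ((summable_norm_bsplineFT_sq hα τ hξ).le_tsum 0 fun _ _ => sq_nonneg _)
  rw [norm_bsplineFT hα]
  gcongr
  refine le_trans (half_le_sinc ?_) (le_abs_self _)
  rw [Int.cast_zero, add_zero, mul_assoc, mul_div_cancel_left₀ _ two_ne_zero, abs_mul,
    abs_of_pos Real.pi_pos, div_eq_mul_one_div]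
  gcongr
  exact abs_le.mpr ⟨by linarith [hξ.1], by linarith [hξ.2]⟩

theorem bsplineGram_pos {α : ℝ} (hα : 0 ≤ α) (τ : ℝ) {ξ : ℝ}
    (hξ : ξ ∈ Set.Ioc (-1 / 2 : ℝ) (-1 / 2 + 1)) : 0 < bsplineGram α τ (2 * Real.pi * ξ) :=
  lt_of_lt_of_le (by positivity) (le_bsplineGram hα τ hξ)

theorem bsplineGram_two_pi_mul_add_int (α τ ξ : ℝ) (k : ℤ) :
    bsplineGram α τ (2 * Real.pi * (ξ + k)) = bsplineGram α τ (2 * Real.pi * ξ) := by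
  rw [mul_add, bsplineGram_add_int]

theorem tsum_enorm_bsplineFT_sq_le {α : ℝ} (hα : 0 ≤ α) (τ : ℝ) {ξ : ℝ}
    (hξ : ξ ∈ Set.Ioc (-1 / 2 : ℝ) (-1 / 2 + 1)) :
    ∑' k : ℤ, ‖bsplineFT α τ (2 * Real.pi * (ξ + k))‖ₑ ^ 2 ≤
      ENNReal.ofReal (∑' k : ℤ, 4 * (1 / |(k : ℝ) + 1 / 2| ^ (2 : ℝ))) := by
  simp_rw [← ofReal_norm, ← ENNReal.ofReal_pow (norm_nonneg _)]
  rw [← ENNReal.ofReal_tsum_of_nonneg (fun _ => sq_nonneg _) (summable_norm_bsplineFT_sq hα τ hξ),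
    ← bsplineGram_two_pi_mul]
  exact ENNReal.ofReal_le_ofReal (bsplineGram_le hα τ hξ)

theorem tsum_ofReal_norm_bsplineFT_sq_div_gram {α : ℝ} (hα : 0 ≤ α) (τ : ℝ) {ξ : ℝ}
    (hξ : ξ ∈ Set.Ioc (-1 / 2 : ℝ) (-1 / 2 + 1)) :
    ∑' k : ℤ, ENNReal.ofReal (‖bsplineFT α τ (2 * Real.pi * (ξ + k))‖ ^ 2 /
      bsplineGram α τ (2 * Real.pi * (ξ + k))) = 1 := by
  have hpos := bsplineGram_pos hα τ hξ
  simp_rw [bsplineGram_two_pi_mul_add_int]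
  rw [← ENNReal.ofReal_tsum_of_nonneg (fun _ => by positivity)
    ((summable_norm_bsplineFT_sq hα τ hξ).div_const _), tsum_div_const, ← bsplineGram_two_pi_mul,
    div_self hpos.ne', ENNReal.ofReal_one]

/-- The Gram function is periodic, so the sum equals its reciprocal, which `le_bsplineGram` bounds.
-/
theorem tsum_enorm_dualBsplineFT_sq_le {α : ℝ} (hα : 0 ≤ α) (τ : ℝ) {ξ : ℝ}
    (hξ : ξ ∈ Set.Ioc (-1 / 2 : ℝ) (-1 / 2 + 1)) :
    ∑' k : ℤ, ‖dualBsplineFT α τ (2 * Real.pi * (ξ + k))‖ₑ ^ 2 ≤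
      ENNReal.ofReal (((1 / 2 : ℝ) ^ (α + 1)) ^ 2)⁻¹ := by
  have hpos := bsplineGram_pos hα τ hξ
  have h : ∀ k : ℤ, ‖dualBsplineFT α τ (2 * Real.pi * (ξ + k))‖ₑ ^ 2 =
      ENNReal.ofReal (‖bsplineFT α τ (2 * Real.pi * (ξ + k))‖ ^ 2 /
        bsplineGram α τ (2 * Real.pi * (ξ + k))) *
        ENNReal.ofReal (bsplineGram α τ (2 * Real.pi * ξ))⁻¹ := by
    intro k
    rw [← ofReal_norm, ← ENNReal.ofReal_pow (norm_nonneg _), dualBsplineFT,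
      bsplineGram_two_pi_mul_add_int, norm_div, Complex.norm_real, Real.norm_of_nonneg hpos.le,
      ← ENNReal.ofReal_mul (by positivity)]
    congr 1
    field_simp
  simp_rw [h]
  rw [ENNReal.tsum_mul_right, tsum_ofReal_norm_bsplineFT_sq_div_gram hα τ hξ, one_mul]
  exact ENNReal.ofReal_le_ofReal (inv_anti₀ (by positivity) (le_bsplineGram hα τ hξ))

/-! ### Splines and dual splines in `L²(ℝ)`; biorthogonality. -/

theorem hasAngularFourier_ofAngularFourier {m : ℝ → ℂ}
    (h : MemLp (fun ξ : ℝ => m (2 * Real.pi * ξ)) 2 volume) :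
    HasAngularFourier (ofAngularFourier m) m := by
  rw [HasAngularFourier, ofAngularFourier, dif_pos h, FourierTransform.fourier_fourierInv_eq]
  exact h.coeFn_toLp

theorem hasAngularFourier_of_tsum_le {m : ℝ → ℂ} (hm : Measurable m) {a C : ℝ}
    (hC : ∀ ξ ∈ Set.Ioc a (a + 1), ∑' k : ℤ, ‖m (2 * Real.pi * (ξ + k))‖ₑ ^ 2 ≤ ENNReal.ofReal C) :
    HasAngularFourier (ofAngularFourier m) m := by
  apply hasAngularFourier_ofAngularFourier
  have h := memLp_comp_mk_mul (m := fun ξ => m (2 * Real.pi * ξ)) (by fun_prop) a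
    ENNReal.ofReal_ne_top hC (memLp_const (1 : ℂ))
  simpa using h

theorem hasAngularFourier_bspline {α : ℝ} (hα : 0 ≤ α) (τ : ℝ) :
    HasAngularFourier (bspline α τ) (bsplineFT α τ) :=
  hasAngularFourier_of_tsum_le (measurable_bsplineFT α τ) fun _ => tsum_enorm_bsplineFT_sq_le hα τ

theorem hasAngularFourier_dualBspline {α : ℝ} (hα : 0 ≤ α) (τ : ℝ) :
    HasAngularFourier (dualBspline α τ) (dualBsplineFT α τ) :=
  hasAngularFourier_of_tsum_le (measurable_dualBsplineFT α τ)
    fun _ => tsum_enorm_dualBsplineFT_sq_le hα τ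

theorem integral_fourier_unitAddCircle (j : ℤ) :
    ∫ t : UnitAddCircle, fourier j t = if j = 0 then 1 else 0 := by
  have h := congrFun (fourierCoeff_fourier (T := 1) j) 0
  rw [fourierCoeff, haarAddCircle_eq_volume] at h
  simp only [neg_zero, fourier_zero, one_smul] at h
  rw [h, Pi.single_apply]
  simp only [eq_comm]

/-- Biorthogonality of the translates of a B-spline and its dual. -/
theorem inner_intTranslate_bspline_dualBspline {α : ℝ} (hα : 0 ≤ α) (τ : ℝ) (m n : ℤ) :
    inner ℂ (intTranslate m (bspline α τ)) (intTranslate n (dualBspline α τ)) =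
      if m = n then 1 else 0 := by
  let w : ℝ → ℝ≥0∞ := fun ξ => ENNReal.ofReal (‖bsplineFT α τ (2 * Real.pi * ξ)‖ ^ 2 /
      bsplineGram α τ (2 * Real.pi * ξ))
  have hw : Measurable w := by
    have h1 := measurable_bsplineFT α τ
    have h2 := measurable_bsplineGram α τ
    fun_prop
  -- The product of the two spectra is the weight `w`, whose push-forward is Haar measure; the inner
  -- product becomes the integral of a character.
  have hmap := map_withDensity_eq hw (-1 / 2)
    fun ξ hξ => tsum_ofReal_norm_bsplineFT_sq_div_gram hα τ hξ
  have hG : ∀ ω, 0 ≤ bsplineGram α τ ω := fun ω => tsum_nonneg fun _ => sq_nonneg _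
  have h0 : inner ℂ (intTranslate m (bspline α τ)) (intTranslate n (dualBspline α τ)) =
      ∫ ξ : ℝ, (w ξ).toReal • fourier (m - n) (ξ : UnitAddCircle) := by
    rw [← Lp.inner_fourier_eq, L2.inner_def]
    refine integral_congr_ae ?_
    filter_upwards [fourier_intTranslate m (bspline α τ), fourier_intTranslate n (dualBspline α τ),
      hasAngularFourier_bspline hα τ, hasAngularFourier_dualBspline hα τ] with ξ h1 h2 h3 h4
    rw [h1, h2, h3, h4, RCLike.inner_apply, map_mul, ← fourier_neg, neg_neg, sub_eq_add_neg,
      fourier_add, ENNReal.toReal_ofReal (div_nonneg (sq_nonneg _) (hG _)), dualBsplineFT,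
      Complex.real_smul, Complex.ofReal_div, Complex.ofReal_pow, ← Complex.mul_conj']
    ring
  rw [h0, ← integral_withDensity_eq_integral_toReal_smul hw
    (Filter.Eventually.of_forall fun _ => ENNReal.ofReal_lt_top),
    ← integral_map (φ := ((↑) : ℝ → UnitAddCircle)) (f := fun t => fourier (m - n) t)
      AddCircle.measurable_mk'.aemeasurable
      (ContinuousMap.continuous _).aestronglyMeasurable, hmap, integral_fourier_unitAddCircle]
  simp only [sub_eq_zero]

/-! ### Phases of the spline and of the filter under a change of shift. -/

/-- Off the branch cut `log` commutes with conjugation, so the product with shift `t` is `exp(2s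
log‖x‖ + 2jt arg x)`: `s` governs the modulus and `t` the phase. -/
theorem cpow_mul_conj_cpow_sub {x : ℂ} (hx : x ≠ 0) (harg : x.arg ≠ Real.pi) (s t t' : ℝ) :
    x ^ ((s + (t - t') : ℝ) : ℂ) * (starRingEnd ℂ) x ^ ((s - (t - t') : ℝ) : ℂ) =
      Complex.exp ((-2 * t' * x.arg : ℝ) * Complex.I) *
        (x ^ ((s + t : ℝ) : ℂ) * (starRingEnd ℂ) x ^ ((s - t : ℝ) : ℂ)) := by
  have hx' : (starRingEnd ℂ) x ≠ 0 := (map_ne_zero _).mpr hx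
  have hlog : Complex.log x = Real.log ‖x‖ + x.arg * Complex.I := rfl
  simp only [Complex.cpow_def_of_ne_zero hx, Complex.cpow_def_of_ne_zero hx',
    Complex.log_conj x harg, ← Complex.exp_add]
  congr 1
  rw [hlog, map_add, map_mul, Complex.conj_ofReal, Complex.conj_ofReal, Complex.conj_I]
  push_cast
  ring

section Phase

variable {ω : ℝ}

theorem re_one_sub_exp_neg_pos (h : Real.cos ω ≠ 1) :
    0 < (1 - Complex.exp (-(Complex.I * ω))).re := by
  have h1 : (1 - Complex.exp (-(Complex.I * ω))).re = 1 - Real.cos ω := by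
    rw [show -(Complex.I * (ω : ℂ)) = ((-ω : ℝ) : ℂ) * Complex.I by push_cast; ring,
      Complex.sub_re, Complex.exp_ofReal_mul_I_re, Real.cos_neg, Complex.one_re]
  rw [h1]
  exact sub_pos.mpr (lt_of_le_of_ne (Real.cos_le_one ω) h)

theorem arg_one_sub_exp_neg (h : Real.cos ω ≠ 1) :
    |(1 - Complex.exp (-(Complex.I * ω))).arg| < Real.pi / 2 :=
  Complex.abs_arg_lt_pi_div_two_iff.mpr (Or.inl (re_one_sub_exp_neg_pos h))

theorem ne_zero_of_cos_ne_one (h : Real.cos ω ≠ 1) : ω ≠ 0 := by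
  rintro rfl
  exact h Real.cos_zero

theorem bsplineBase_ne_zero (h : Real.cos ω ≠ 1) : bsplineBase ω ≠ 0 := by
  have h0 := ne_zero_of_cos_ne_one h
  rw [bsplineBase, if_neg h0]
  refine div_ne_zero (fun h1 => ?_) (mul_ne_zero Complex.I_ne_zero (Complex.ofReal_ne_zero.mpr h0))
  have := re_one_sub_exp_neg_pos h
  rw [h1] at this
  exact lt_irrefl _ this

/-- Up to a positive factor, division by `jω` is multiplication by `-j sign ω`. Since `|arg u| <
π/2`, the rotated argument stays in `(-π, π)` and no multiple of `2π` appears. -/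
theorem arg_bsplineBase (h : Real.cos ω ≠ 1) :
    (bsplineBase ω).arg = (1 - Complex.exp (-(Complex.I * ω))).arg -
      Real.pi / 2 * (SignType.sign ω : ℝ) := by
  have h0 := ne_zero_of_cos_ne_one h
  have hI := Complex.I_ne_zero
  have h0' : (ω : ℂ) ≠ 0 := Complex.ofReal_ne_zero.mpr h0
  have hb := abs_lt.mp (arg_one_sub_exp_neg h)
  have hu : 1 - Complex.exp (-(Complex.I * ω)) ≠ 0 := by
    intro h1
    have := re_one_sub_exp_neg_pos h
    rw [h1] at this
    exact lt_irrefl _ this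
  rw [bsplineBase, if_neg h0]
  set u := 1 - Complex.exp (-(Complex.I * ω))
  have hpi := Real.pi_pos
  rcases h0.lt_or_gt with hω | hω
  · have h1 : u / (Complex.I * ω) = (((-ω)⁻¹ : ℝ) : ℂ) * (u * Complex.I) := by
      push_cast
      field_simp
      rw [Complex.I_sq]
      ring
    rw [h1, Complex.arg_real_mul _ (inv_pos.mpr (neg_pos.mpr hω)), Complex.arg_mul hu hI
      (by rw [Complex.arg_I]; constructor <;> linarith), Complex.arg_I, sign_neg hω]
    simp
  · have h1 : u / (Complex.I * ω) = ((ω⁻¹ : ℝ) : ℂ) * (u * -Complex.I) := by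
      push_cast
      field_simp
      rw [Complex.I_sq]
      ring
    rw [h1, Complex.arg_real_mul _ (inv_pos.mpr hω), Complex.arg_mul hu (neg_ne_zero.mpr hI)
      (by rw [Complex.arg_neg_I]; constructor <;> linarith), Complex.arg_neg_I, sign_pos hω]
    simp
    ring

theorem bsplineFT_sub (α τ τ' : ℝ) (h : Real.cos ω ≠ 1) :
    bsplineFT α (τ - τ') ω =
      Complex.exp ((-2 * τ' * (bsplineBase ω).arg : ℝ) * Complex.I) * bsplineFT α τ ω := by
  have harg : (bsplineBase ω).arg ≠ Real.pi := by
    rw [arg_bsplineBase h]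
    have hb := abs_lt.mp (arg_one_sub_exp_neg h)
    have hpi := Real.pi_pos
    rcases (ne_zero_of_cos_ne_one h).lt_or_gt with hω | hω
    · rw [sign_neg hω]
      refine ne_of_lt ?_
      simp
      linarith
    · rw [sign_pos hω]
      refine ne_of_lt ?_
      simp
      linarith
  rw [bsplineFT, bsplineFT, bsplineBase_neg,
    cpow_mul_conj_cpow_sub (bsplineBase_ne_zero h) harg]

/-- At `-z⁻¹` the base carrying the exponent with `+τ` is the conjugate of `1 - exp(-jω)`, hence a
phase of sign opposite to that in `bsplineFT_sub`. -/
theorem refinementFilter_sub (α τ τ' : ℝ) (h : Real.cos ω ≠ 1) :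
    refinementFilter α (τ - τ') (-(Complex.exp (Complex.I * ω))⁻¹) =
      Complex.exp ((2 * τ' * (1 - Complex.exp (-(Complex.I * ω))).arg : ℝ) * Complex.I) *
        refinementFilter α τ (-(Complex.exp (Complex.I * ω))⁻¹) := by
  have hre := re_one_sub_exp_neg_pos h
  have hb := abs_lt.mp (arg_one_sub_exp_neg h)
  have hpi := Real.pi_pos
  have hconj : 1 + (-(Complex.exp (Complex.I * ω))⁻¹)⁻¹ =
      (starRingEnd ℂ) (1 - Complex.exp (-(Complex.I * ω))) := by
    rw [map_sub, map_one, ← Complex.exp_conj, map_neg, map_mul, Complex.conj_I,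
      Complex.conj_ofReal, ← neg_inv, inv_inv]
    simp [sub_eq_add_neg]
  have hu : 1 + -(Complex.exp (Complex.I * ω))⁻¹ = 1 - Complex.exp (-(Complex.I * ω)) := by
    rw [Complex.exp_neg, sub_eq_add_neg]
  rw [refinementFilter, refinementFilter, hconj, hu]
  set u := 1 - Complex.exp (-(Complex.I * ω))
  have hu0 : u ≠ 0 := fun h1 => by simp [h1] at hre
  have hca : ((starRingEnd ℂ) u).arg = -u.arg := by
    rw [Complex.arg_conj, if_neg (by linarith)]
  have := cpow_mul_conj_cpow_sub (x := (starRingEnd ℂ) u) ((map_ne_zero _).mpr hu0)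
    (by rw [hca]; linarith) ((α + 1) / 2) τ τ'
  rw [Complex.conj_conj, hca] at this
  rw [this]
  simp only [mul_neg, neg_mul, neg_neg]
  ring

/-- The product of the wavelet filter and the B-spline changes by the phase of the fractional
Hilbert transform when the shift is changed. -/
theorem waveletFilter_mul_bsplineFT_sub (α τ τ' : ℝ) (Q : ℂ → ℂ) (h : Real.cos ω ≠ 1) :
    waveletFilter α (τ - τ') Q (Complex.exp (Complex.I * ω)) * bsplineFT α (τ - τ') ω =
      fHTPhase τ' ω *
        (waveletFilter α τ Q (Complex.exp (Complex.I * ω)) * bsplineFT α τ ω) := by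
  have hphase : fHTPhase τ' ω =
      Complex.exp ((2 * τ' * (1 - Complex.exp (-(Complex.I * ω))).arg : ℝ) * Complex.I) *
        Complex.exp ((-2 * τ' * (bsplineBase ω).arg : ℝ) * Complex.I) := by
    rw [fHTPhase, ← Complex.exp_add, ← add_mul, ← Complex.ofReal_add, arg_bsplineBase h]
    congr 3
    ring
  rw [waveletFilter, waveletFilter, bsplineFT_sub α τ τ' h, refinementFilter_sub α τ τ' h, hphase]
  ring

end Phase

/-! ### Transfer functions on the circle and their Fourier coefficients. -/

theorem ae_cos_ne_one : ∀ᵐ ξ : ℝ, Real.cos (2 * Real.pi * ξ) ≠ 1 := by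
  filter_upwards [(Set.countable_range ((↑) : ℤ → ℝ)).ae_notMem volume] with ξ hξ h
  obtain ⟨n, hn⟩ := (Real.cos_eq_one_iff _).mp h
  refine hξ ⟨n, ?_⟩
  have := Real.pi_pos
  have h2 : (n - ξ) * (2 * Real.pi) = 0 := by linarith
  rcases mul_eq_zero.mp h2 with h3 | h3 <;> linarith

/-- The transfer function of a filter as a function on the circle `ℝ / ℤ`. -/
noncomputable def circleTransfer (G : ℂ → ℂ) (t : UnitAddCircle) : ℂ := G (AddCircle.toCircle t)

theorem circleTransfer_coe (G : ℂ → ℂ) (ξ : ℝ) :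
    circleTransfer G ξ = G (Complex.exp (Complex.I * ((2 * Real.pi * ξ : ℝ) : ℂ))) := by
  rw [circleTransfer, AddCircle.toCircle_apply_mk, Circle.coe_exp, div_one, mul_comm Complex.I]

theorem IsFilter.memLp_circleTransfer {Q : ℂ → ℂ} (hQ : IsFilter Q) :
    MemLp (circleTransfer Q) 2 volume := by
  have h2pi : (2 * Real.pi) ≠ 0 := by positivity
  have hpi := Real.pi_pos
  have h1 : MemLp (fun ξ : ℝ => circleTransfer Q ξ) 2
      (volume.restrict (Set.Ioc (-1 / 2 : ℝ) (-1 / 2 + 1))) := by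
    simp_rw [circleTransfer_coe]
    refine MemLp.comp_of_map (f := fun ξ : ℝ => 2 * Real.pi * ξ)
      (g := fun ω : ℝ => Q (Complex.exp (Complex.I * ω))) ?_ (by fun_prop)
    have hpre : Set.Ioc (-1 / 2 : ℝ) (-1 / 2 + 1) =
        (fun ξ : ℝ => 2 * Real.pi * ξ) ⁻¹' Set.Ioc (-Real.pi) Real.pi := by
      ext x
      simp only [Set.mem_Ioc, Set.mem_preimage]
      constructor <;> rintro ⟨h1, h2⟩ <;> constructor <;> nlinarith
    rw [hpre, ← Measure.restrict_map (by fun_prop) measurableSet_Ioc,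
      Real.map_volume_mul_left h2pi, Measure.restrict_smul]
    exact hQ.smul_measure ENNReal.ofReal_ne_top
  have h2 := h1.memLp_liftIoc (T := 1)
  convert h2 using 1
  funext t
  obtain ⟨x, hx, rfl⟩ : ∃ x ∈ Set.Ioc (-1 / 2 : ℝ) (-1 / 2 + 1), (x : UnitAddCircle) = t := by
    have := AddCircle.coe_image_Ioc_eq (1 : ℝ) (-1 / 2)
    have ht : t ∈ ((↑) : ℝ → UnitAddCircle) '' Set.Ioc (-1 / 2 : ℝ) (-1 / 2 + 1) := by
      rw [this]; trivial
    exact ht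
  rw [AddCircle.liftIoc_coe_apply hx]

/-- The two bases have equal modulus at most `2` and the exponents add up to `α + 1`, which the
normalising factor compensates. -/
theorem norm_refinementFilter_le {α : ℝ} (hα : 0 ≤ α) (τ : ℝ) {z : ℂ} (hz : ‖z‖ = 1) :
    ‖refinementFilter α τ z‖ ≤ 1 := by
  have hz0 : z ≠ 0 := by
    rintro rfl
    simp at hz
  have hn : ‖1 + z⁻¹‖ = ‖1 + z‖ := by
    have : 1 + z⁻¹ = z⁻¹ * (1 + z) := by
      field_simp
      ring
    rw [this, norm_mul, norm_inv, hz, inv_one, one_mul]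
  have h2 : ‖1 + z⁻¹‖ ≤ 2 := by
    rw [hn]
    refine (norm_add_le _ _).trans ?_
    rw [norm_one, hz]
    norm_num
  rw [refinementFilter, norm_mul, norm_cpow_mul_cpow hn (by linarith), Complex.norm_real,
    Real.norm_of_nonneg (by positivity), inv_mul_le_iff₀ (by positivity), mul_one]
  calc ‖1 + z⁻¹‖ ^ ((α + 1) / 2 + τ + ((α + 1) / 2 - τ)) = ‖1 + z⁻¹‖ ^ (α + 1) := by
        congr 1
        ring
    _ ≤ 2 ^ (α + 1) := Real.rpow_le_rpow (norm_nonneg _) h2 (by linarith)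

theorem measurable_refinementFilter (α τ : ℝ) : Measurable (refinementFilter α τ) := by
  unfold refinementFilter
  fun_prop

theorem IsFilter.memLp_waveletFilter {α : ℝ} (hα : 0 ≤ α) (τ : ℝ) {Q : ℂ → ℂ} (hQ : IsFilter Q) :
    MemLp (circleTransfer (waveletFilter α τ Q)) 2 volume := by
  -- The half-turn: `t ↦ c - t` realises `z ↦ -z⁻¹` as a measure-preserving map of the circle.
  let c : UnitAddCircle := ((1 / 2 : ℝ) : UnitAddCircle)
  have hc : ((AddCircle.toCircle c : Circle) : ℂ) = -1 := by
    rw [AddCircle.toCircle_apply_mk, Circle.coe_exp, ← Complex.exp_pi_mul_I]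
    congr 2
    push_cast
    ring
  have hsub : ∀ t : UnitAddCircle, ((AddCircle.toCircle (c - t) : Circle) : ℂ) =
      -((AddCircle.toCircle t : Circle) : ℂ)⁻¹ := by
    intro t
    rw [sub_eq_add_neg, AddCircle.toCircle_add, AddCircle.toCircle_neg, Circle.coe_mul, hc,
      Circle.coe_inv, neg_one_mul]
  have h1 : MemLp (fun t => circleTransfer Q (c - t)) 2 volume :=
    hQ.memLp_circleTransfer.comp_measurePreserving (Measure.measurePreserving_sub_left volume c)
  have heq : circleTransfer (waveletFilter α τ Q) = fun t =>
      ((AddCircle.toCircle t : Circle) : ℂ) * circleTransfer Q (c - t) *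
        refinementFilter α τ (-((AddCircle.toCircle t : Circle) : ℂ)⁻¹) := by
    funext t
    rw [circleTransfer, waveletFilter, circleTransfer, hsub]
  have hm : Measurable fun t : UnitAddCircle => ((AddCircle.toCircle t : Circle) : ℂ) :=
    (continuous_subtype_val.comp AddCircle.continuous_toCircle).measurable
  rw [heq]
  refine h1.of_le ((hm.aestronglyMeasurable.mul h1.1).mul
    ((measurable_refinementFilter α τ).comp hm.inv.neg).aestronglyMeasurable)
    (Filter.Eventually.of_forall fun t => ?_)
  rw [norm_mul, norm_mul, Circle.norm_coe, one_mul]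
  refine mul_le_of_le_one_right (norm_nonneg _) (norm_refinementFilter_le hα τ ?_)
  rw [norm_neg, norm_inv, Circle.norm_coe, inv_one]

theorem impulseResponse_eq_fourierCoeff (G : ℂ → ℂ) (k : ℤ) :
    impulseResponse G k = fourierCoeff (circleTransfer G) (-k) := by
  have h2pi : (2 * Real.pi) ≠ 0 := by positivity
  rw [fourierCoeff_eq_intervalIntegral _ _ (-1 / 2), impulseResponse]
  let F : ℝ → ℂ := fun ω =>
    G (Complex.exp (Complex.I * ω)) * Complex.exp (Complex.I * k * ω)
  have h : ∀ x : ℝ, fourier (- -k) (x : UnitAddCircle) • circleTransfer G x =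
      F (2 * Real.pi * x) := by
    intro x
    rw [circleTransfer_coe, fourier_coe_apply, smul_eq_mul, mul_comm]
    simp only [F]
    congr 2
    push_cast
    ring
  simp_rw [h]
  rw [intervalIntegral.integral_comp_mul_left F h2pi, div_one, one_smul, Complex.real_smul,
    show 2 * Real.pi * (-1 / 2) = -Real.pi by ring,
    show 2 * Real.pi * (-1 / 2 + 1) = Real.pi by ring, Complex.ofReal_inv]

/-! ### Generated wavelets and the action of the fractional Hilbert transform. -/

section Generate

variable {m : ℝ → ℂ} {a C : ℝ} {φ : L2R} {G : ℂ → ℂ}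

theorem hasSum_generate (hm : Measurable m)
    (hC : ∀ ξ ∈ Set.Ioc a (a + 1), ∑' k : ℤ, ‖m (2 * Real.pi * (ξ + k))‖ₑ ^ 2 ≤ ENNReal.ofReal C)
    (hφ : HasAngularFourier φ m) (hG : MemLp (circleTransfer G) 2 volume) :
    HasSum (fun k : ℤ => impulseResponse G k • intTranslate k φ)
        (∑' k : ℤ, impulseResponse G k • intTranslate k φ) ∧
      HasAngularFourier (∑' k : ℤ, impulseResponse G k • intTranslate k φ)
        fun ω => G (Complex.exp (Complex.I * ω)) * m ω := by
  obtain ⟨S, hS, hFS⟩ := exists_hasSum_intTranslate (m := fun ξ => m (2 * Real.pi * ξ))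
    (by fun_prop) a ENNReal.ofReal_ne_top hC hφ hG
  simp_rw [← impulseResponse_eq_fourierCoeff, circleTransfer_coe] at hS hFS
  rw [hS.tsum_eq]
  exact ⟨hS, hFS⟩

theorem isGenerated_generate (hm : Measurable m)
    (hC : ∀ ξ ∈ Set.Ioc a (a + 1), ∑' k : ℤ, ‖m (2 * Real.pi * (ξ + k))‖ₑ ^ 2 ≤ ENNReal.ofReal C)
    (hφ : HasAngularFourier φ m) (hG : MemLp (circleTransfer G) 2 volume) :
    IsGenerated G φ (generate G φ) := by
  rw [IsGenerated, generate, affineComp_affineComp_inv]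
  exact (hasSum_generate hm hC hφ hG).1

end Generate

theorem fHT_affineComp_of_hasAngularFourier {S S' : L2R} {M M' : ℝ → ℂ} (τ : ℝ)
    (hS : HasAngularFourier S M) (hS' : HasAngularFourier S' M')
    (h : ∀ ω, Real.cos ω ≠ 1 → M' ω = fHTPhase τ ω * M ω) :
    fHT τ (affineComp 2 0 two_ne_zero S) = affineComp 2 0 two_ne_zero S' := by
  rw [fHT_affineComp τ 0 two_pos]
  congr 1
  apply L2R.ext_fourier
  filter_upwards [fourier_fHT τ S, hS, hS', ae_cos_ne_one] with ξ h1 h2 h3 h4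
  rw [h1, h2, h3, h _ h4, fHTPhase_mul_of_pos τ Real.two_pi_pos]

theorem isGenerated_splineWavelet {α : ℝ} (hα : 0 ≤ α) {Q : ℂ → ℂ} (hQ : IsFilter Q) (τ : ℝ) :
    IsGenerated (waveletFilter α τ Q) (bspline α τ) (splineWavelet α Q τ) :=
  isGenerated_generate (measurable_bsplineFT α τ) (fun _ => tsum_enorm_bsplineFT_sq_le hα τ)
    (hasAngularFourier_bspline hα τ) (hQ.memLp_waveletFilter hα τ)

theorem isGenerated_dualSplineWavelet {α : ℝ} (hα : 0 ≤ α) {Q : ℂ → ℂ} (hQ : IsFilter Q) (τ : ℝ) :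
    IsGenerated (waveletFilter α τ Q) (dualBspline α τ) (dualSplineWavelet α Q τ) :=
  isGenerated_generate (measurable_dualBsplineFT α τ) (fun _ => tsum_enorm_dualBsplineFT_sq_le hα τ)
    (hasAngularFourier_dualBspline hα τ) (hQ.memLp_waveletFilter hα τ)

theorem fHT_splineWavelet {α : ℝ} (hα : 0 ≤ α) {Q : ℂ → ℂ} (hQ : IsFilter Q) (τ τ' : ℝ) :
    fHT τ' (splineWavelet α Q τ) = splineWavelet α Q (τ - τ') := by
  have h := fun σ : ℝ => (hasSum_generate (measurable_bsplineFT α σ)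
    (fun _ => tsum_enorm_bsplineFT_sq_le hα σ) (hasAngularFourier_bspline hα σ)
    (hQ.memLp_waveletFilter hα σ)).2
  exact fHT_affineComp_of_hasAngularFourier τ' (h τ) (h (τ - τ'))
    fun ω hω => waveletFilter_mul_bsplineFT_sub α τ τ' Q hω

/-- The denominators for the two shifts coincide by `bsplineGram_eq`, so the phase identity for the
B-spline carries over. -/
theorem fHT_dualSplineWavelet {α : ℝ} (hα : 0 ≤ α) {Q : ℂ → ℂ} (hQ : IsFilter Q) (τ τ' : ℝ) :
    fHT τ' (dualSplineWavelet α Q τ) = dualSplineWavelet α Q (τ - τ') := by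
  have h := fun σ : ℝ => (hasSum_generate (measurable_dualBsplineFT α σ)
    (fun _ => tsum_enorm_dualBsplineFT_sq_le hα σ) (hasAngularFourier_dualBspline hα σ)
    (hQ.memLp_waveletFilter hα σ)).2
  refine fHT_affineComp_of_hasAngularFourier τ' (h τ) (h (τ - τ')) fun ω hω => ?_
  rw [dualBsplineFT, dualBsplineFT, bsplineGram_eq hα (τ - τ') τ, ← mul_div_assoc,
    waveletFilter_mul_bsplineFT_sub α τ τ' Q hω]
  ring

theorem mainTheorem5 (α : ℝ) (hα : 0 ≤ α) (Q Q' : ℂ → ℂ) (hQ : IsFilter Q) (hQ' : IsFilter Q') :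
    -- the splines and the wavelets of all shifts are well defined
    (∀ τ : ℝ,
      HasAngularFourier (bspline α τ) (bsplineFT α τ) ∧
      HasAngularFourier (dualBspline α τ) (dualBsplineFT α τ) ∧
      (∀ m n : ℤ, inner ℂ (intTranslate m (bspline α τ)) (intTranslate n (dualBspline α τ)) =
        if m = n then 1 else 0) ∧
      IsGenerated (waveletFilter α τ Q) (bspline α τ) (splineWavelet α Q τ) ∧
      IsGenerated (waveletFilter α τ Q') (dualBspline α τ) (dualSplineWavelet α Q' τ)) ∧
    -- the fractional Hilbert transform only changes the shift
    (∀ τ τ' : ℝ,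
      fHT τ' (splineWavelet α Q τ) = splineWavelet α Q (τ - τ') ∧
      fHT τ' (dualSplineWavelet α Q' τ) = dualSplineWavelet α Q' (τ - τ') ∧
      -- and the new wavelets are of the same genus
      (IsOrthonormalWavelet (splineWavelet α Q τ) →
        IsOrthonormalWavelet (splineWavelet α Q (τ - τ'))) ∧
      (IsSemiorthogonalWavelet (splineWavelet α Q τ) →
        IsSemiorthogonalWavelet (splineWavelet α Q (τ - τ'))) ∧
      (IsDualPair (splineWavelet α Q τ) (dualSplineWavelet α Q' τ) →
        IsDualPair (splineWavelet α Q (τ - τ')) (dualSplineWavelet α Q' (τ - τ')))) := by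
  refine ⟨fun τ => ⟨hasAngularFourier_bspline hα τ, hasAngularFourier_dualBspline hα τ,
    inner_intTranslate_bspline_dualBspline hα τ, isGenerated_splineWavelet hα hQ τ,
    isGenerated_dualSplineWavelet hα hQ' τ⟩, fun τ τ' => ?_⟩
  have h := fHT_splineWavelet hα hQ τ τ'
  have h' := fHT_dualSplineWavelet hα hQ' τ τ'
  refine ⟨h, h', ?_⟩
  -- Once the new wavelets are written as transforms of the old ones, the three implications are
  -- instances of invariance under `fHT`.
  rw [← h, ← h']
  exact ⟨fun hψ => hψ.fHT τ', fun hψ => hψ.fHT τ', fun hψ => hψ.fHT τ'⟩
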